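/- Let $\sigma,\alpha,\tau,m,M,K>0$ with $\alpha\le K$, and let $a\in H^1(0,1)$ (identified with its continuous representative) satisfy $a(x)\ge a_0>0$ for all $x\in[0,1]$. Let $\mathcal H_0=H^1(0,1)\times L^2(0,1)\times L^2(0,1)\times\mathbb R^2$ (real-valued functions), and let $\mathcal A_0$ be the linear operator in $\mathcal H_0$ with domain $$\mathcal D(\mathcal A_0)=\{(y,z,u,\xi,\eta)\in\mathcal H_0:\ y\in H^2(0,1),\ z,u\in H^1(0,1),\ \xi=u(0)=z(0),\ \eta=z(1)\}$$ and $$\mathcal A_0(y,z,u,\xi,\eta)=\Big(z,\ (ay_x)_x-\sigma z,\ -\tfrac{u_x}{\tau},\ \tfrac1m\big[(ay_x)(0)+\alpha u(1)\big],\ -\tfrac{(ay_x)(1)}{M}\Big).$$ **Theorem.** (A) In $\mathcal H_0$ with its usual product topology the following hold. 1. $\mathcal A_0$ is densely defined and generates a $C_0$-semigroup $e^{t\mathcal A_0}$, $t\ge 0$, on $\mathcal H_0$. 2. If $\Phi_0\in\mathcal D(\mathcal A_0)$, then $\Phi(t)=e^{t\mathcal A_0}\Phi_0$ is the unique strong solution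 of $\Phi_t=\mathcal A_0\Phi$, $\Phi(0)=\Phi_0$, and $\Phi\in C([0,\infty);\mathcal D(\mathcal A_0))\cap C^1([0,\infty);\mathcal H_0)$, where $\mathcal D(\mathcal A_0)$ carries the graph norm. 3. For every $\Phi_0\in\mathcal H_0$ the same problem has a unique mild solution $\Phi\in C([0,\infty);\mathcal H_0)$, namely $\Phi(t)=e^{t\mathcal A_0}\Phi_0$. Here a mild solution is a continuous function $\Phi$ such that, for all $t\ge0$, $\int_0^t\Phi(s)\,ds\in\mathcal D(\mathcal A_0)$ and $\Phi(t)=\Phi_0+\mathcal A_0\int_0^t\Phi(s)\,ds$. (B) Suppose moreover that $\sigma\ne\alpha$ and let $\varpi>0$. Then $$\begin{aligned}\langle(y,z,u,\xi,\eta),(\tilde y,\tilde z,\tilde u,\tilde\xi,\tilde\eta)\rangle={}&\int_0^1(ay_x\tilde y_x+z\tilde z)\,dx+K\tau\int_0^1u\tilde u\,dx+m\xi\tilde\xi+M\eta\tilde\eta\\&+\varpi\,\ell(y,z,u,\xi,\eta)\,\ell(\tilde y,\tilde z,\tilde u,\tilde\xi,\tilde\eta),\end{aligned}$$ $$\ell(y,z,u,\xi,\eta)=\int_0^1(\sigma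 y+z)\,dx+m\xi+M\eta-\alpha y(0)+\tau\alpha\int_0^1u\,dx,$$ is an inner product on $\mathcal H_0$, its norm is equivalent to the usual norm of $\mathcal H_0$, and 1.–3. hold in $\mathcal H_0$ equipped with this inner product. -/

import Mathlib

open MeasureTheory Set Filter Topology
open scoped ContDiff

noncomputable section

namespace Crane

/-- Lebesgue measure on the interval `(0, 1)`. -/
abbrev unitMeasure : Measure ℝ := volume.restrict (Ioo (0 : ℝ) 1)

/-- The real Hilbert space `L²(0, 1)`. -/
abbrev L2 : Type := Lp ℝ 2 unitMeasure

/-- `g` is the weak derivative of `f` on `(0, 1)`. -/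
def IsWeakDeriv (f g : L2) : Prop :=
  ∀ φ : ℝ → ℝ, ContDiff ℝ ∞ φ → HasCompactSupport φ → tsupport φ ⊆ Ioo (0 : ℝ) 1 →
    ∫ x in Ioo (0 : ℝ) 1, f x * deriv φ x = - ∫ x in Ioo (0 : ℝ) 1, g x * φ x

theorem L2.integrable (f : L2) : IntegrableOn f (Ioo (0 : ℝ) 1) volume :=
  (Lp.memLp f).integrable (by norm_num)

theorem L2.intervalIntegrable (f : L2) : IntervalIntegrable f volume 0 1 := by
  rw [intervalIntegrable_iff, uIoc_of_le zero_le_one, integrableOn_Ioc_iff_integrableOn_Ioo]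
  exact f.integrable

theorem integrable_mul_test {h φ : ℝ → ℝ} (hh : IntegrableOn h (Ioo (0 : ℝ) 1) volume)
    (hφ : Continuous φ) (hc : HasCompactSupport φ) :
    IntegrableOn (fun x => h x * φ x) (Ioo (0 : ℝ) 1) volume := by
  obtain ⟨C, hC⟩ := hc.exists_bound_of_continuous hφ
  exact hh.mul_bdd (c := C) hφ.aestronglyMeasurable (ae_of_all _ hC)

theorem L2.integrable_mul (f g : L2) : Integrable (fun x => f x * g x) unitMeasure :=
  (Lp.memLp f).integrable_mul (Lp.memLp g)

theorem IsWeakDeriv.add {f g f' g' : L2} (h : IsWeakDeriv f g) (h' : IsWeakDeriv f' g') :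
    IsWeakDeriv (f + f') (g + g') := by
  intro φ h1 h2 h3
  have e1 : ∫ x in Ioo (0 : ℝ) 1, (f + f') x * deriv φ x
      = ∫ x in Ioo (0 : ℝ) 1, (f x * deriv φ x + f' x * deriv φ x) := by
    apply integral_congr_ae
    filter_upwards [Lp.coeFn_add f f'] with x hx
    rw [hx, Pi.add_apply]; ring
  have e2 : ∫ x in Ioo (0 : ℝ) 1, (g + g') x * φ x
      = ∫ x in Ioo (0 : ℝ) 1, (g x * φ x + g' x * φ x) := by
    apply integral_congr_ae
    filter_upwards [Lp.coeFn_add g g'] with x hx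
    rw [hx, Pi.add_apply]; ring
  have hd : Continuous (deriv φ) := h1.continuous_deriv (by norm_num)
  rw [e1, e2, integral_add (integrable_mul_test f.integrable hd h2.deriv)
    (integrable_mul_test f'.integrable hd h2.deriv),
    integral_add (integrable_mul_test g.integrable h1.continuous h2)
    (integrable_mul_test g'.integrable h1.continuous h2), h φ h1 h2 h3, h' φ h1 h2 h3]
  ring

theorem IsWeakDeriv.smul {f g : L2} (c : ℝ) (h : IsWeakDeriv f g) :
    IsWeakDeriv (c • f) (c • g) := by
  intro φ h1 h2 h3
  have e1 : ∫ x in Ioo (0 : ℝ) 1, (c • f) x * deriv φ x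
      = ∫ x in Ioo (0 : ℝ) 1, c * (f x * deriv φ x) := by
    apply integral_congr_ae
    filter_upwards [Lp.coeFn_smul c f] with x hx
    rw [hx, Pi.smul_apply, smul_eq_mul]; ring
  have e2 : ∫ x in Ioo (0 : ℝ) 1, (c • g) x * φ x
      = ∫ x in Ioo (0 : ℝ) 1, c * (g x * φ x) := by
    apply integral_congr_ae
    filter_upwards [Lp.coeFn_smul c g] with x hx
    rw [hx, Pi.smul_apply, smul_eq_mul]; ring
  rw [e1, e2, integral_const_mul, integral_const_mul, h φ h1 h2 h3]
  ring

theorem isWeakDeriv_zero : IsWeakDeriv 0 0 := by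
  simpa using IsWeakDeriv.smul (f := 0) (g := 0) 0 (by
    intro φ _ _ _
    have e : ∀ ψ : ℝ → ℝ, ∫ x in Ioo (0 : ℝ) 1, (0 : L2) x * ψ x = 0 := by
      intro ψ
      apply integral_eq_zero_of_ae
      filter_upwards [Lp.coeFn_zero ℝ 2 unitMeasure] with x hx
      rw [hx]; simp
    rw [e, e, neg_zero])

/-- The Sobolev space `H¹(0, 1)`: an element is a function in `L²` together with its weak
derivative in `L²`, with the norm `(‖f‖² + ‖f'‖²)^(1/2)`. -/
def sobolevH1 : Submodule ℝ (WithLp 2 (L2 × L2)) where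
  carrier := {p | IsWeakDeriv p.fst p.snd}
  add_mem' := fun h h' => IsWeakDeriv.add h h'
  zero_mem' := isWeakDeriv_zero
  smul_mem' := fun c _ h => IsWeakDeriv.smul c h

abbrev H1 : Type := sobolevH1

/-- The inclusion `H¹(0, 1) → L²(0, 1)`. -/
def H1.toL2 : H1 →ₗ[ℝ] L2 where
  toFun f := f.1.fst
  map_add' _ _ := rfl
  map_smul' _ _ := rfl

/-- The weak derivative `H¹(0, 1) → L²(0, 1)`. -/
def H1.der : H1 →ₗ[ℝ] L2 where
  toFun f := f.1.snd
  map_add' _ _ := rfl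
  map_smul' _ _ := rfl

theorem H1.isWeakDeriv (f : H1) : IsWeakDeriv f.toL2 f.der := f.2

theorem ae_const_of_integral_mul_deriv_eq_zero {h : ℝ → ℝ}
    (hh : IntegrableOn h (Ioo (0 : ℝ) 1) volume)
    (h0 : ∀ φ : ℝ → ℝ, ContDiff ℝ ∞ φ → HasCompactSupport φ → tsupport φ ⊆ Ioo (0 : ℝ) 1 →
      ∫ x in Ioo (0 : ℝ) 1, h x * deriv φ x = 0) :
    ∃ c : ℝ, h =ᵐ[unitMeasure] fun _ => c := by
  let b : ContDiffBump (1 / 2 : ℝ) := ⟨1 / 8, 1 / 4, by norm_num, by norm_num⟩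
  let ψ : ℝ → ℝ := b.normed volume
  have hψ : ContDiff ℝ ∞ ψ := b.contDiff_normed
  have hψc : HasCompactSupport ψ := b.hasCompactSupport_normed
  have hψs : tsupport ψ ⊆ Ioo (0 : ℝ) 1 := by
    rw [show tsupport ψ = _ from b.tsupport_normed_eq, Real.closedBall_eq_Icc]
    intro x hx
    constructor <;> [have := hx.1; have := hx.2] <;> norm_num [b] at this <;> linarith
  have hψ1 : ∫ x, ψ x = 1 := b.integral_normed
  set c : ℝ := ∫ x in Ioo (0 : ℝ) 1, h x * ψ x with hc
  refine ⟨c, ?_⟩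
  have key := IsOpen.ae_eq_zero_of_integral_contDiff_smul_eq_zero (μ := unitMeasure)
    (f := fun x => h x - c) (isOpen_Ioo (a := (0 : ℝ)) (b := 1))
    ((hh.sub (integrable_const c)).locallyIntegrable.locallyIntegrableOn _) ?_
  · have := (ae_restrict_iff' (μ := volume) (measurableSet_Ioo (a := (0 : ℝ)) (b := 1))).2
      ((ae_restrict_iff' (μ := volume) (measurableSet_Ioo (a := (0 : ℝ)) (b := 1))).1 key |>.mono
        fun x hx hx' => hx hx' hx')
    filter_upwards [this] with x hx
    linarith
  intro η hη hηc hηs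
  set d : ℝ := ∫ x, η x with hd
  let χ : ℝ → ℝ := fun x => η x - d * ψ x
  have hχ : ContDiff ℝ ∞ χ := hη.sub (contDiff_const.mul hψ)
  have hχi : ∫ x, χ x = 0 := by
    have e : ∫ x, χ x = (∫ x, η x) - ∫ x, d * ψ x := integral_sub
      (hη.continuous.integrable_of_hasCompactSupport hηc)
      ((hψ.continuous.integrable_of_hasCompactSupport hψc).const_mul d)
    rw [e, integral_const_mul, hψ1]; simp [hd]
  let S : Set ℝ := tsupport η ∪ tsupport ψ
  have hS : IsCompact S := hηc.isCompact.union hψc.isCompact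
  have hne : S.Nonempty := by
    refine Set.Nonempty.inr ?_
    rw [show tsupport ψ = _ from b.tsupport_normed_eq]
    exact ⟨1 / 2, by simp [b.rOut_pos.le]⟩
  have hSs : S ⊆ Ioo (0 : ℝ) 1 := union_subset hηs hψs
  obtain ⟨p, hpS, hp⟩ := hS.exists_isMinOn hne continuousOn_id
  obtain ⟨q, hqS, hq⟩ := hS.exists_isMaxOn hne continuousOn_id
  have hp' : ∀ x ∈ S, p ≤ x := fun x hx => hp hx
  have hq' : ∀ x ∈ S, x ≤ q := fun x hx => hq hx
  have hχ0 : ∀ x, x ∉ S → χ x = 0 := by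
    intro x hx
    have h1 : η x = 0 := image_eq_zero_of_notMem_tsupport fun h => hx (Or.inl h)
    have h2 : ψ x = 0 := image_eq_zero_of_notMem_tsupport fun h => hx (Or.inr h)
    simp [χ, h1, h2]
  let Φ : ℝ → ℝ := fun x => ∫ t in p..x, χ t
  have hΦd : ∀ x, HasDerivAt Φ (χ x) x := fun x =>
    intervalIntegral.integral_hasDerivAt_right (hχ.continuous.intervalIntegrable _ _)
      (hχ.continuous.stronglyMeasurableAtFilter _ _) hχ.continuous.continuousAt
  have hΦd' : deriv Φ = χ := funext fun x => (hΦd x).deriv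
  have hΦ : ContDiff ℝ ∞ Φ := by
    rw [contDiff_infty_iff_deriv, hΦd']
    exact ⟨fun x => (hΦd x).differentiableAt, hχ⟩
  have hΦz : ∀ x, x ∉ Icc p q → Φ x = 0 := by
    intro x hx
    rcases lt_or_ge x p with h | h
    · have : ∀ t ∈ uIoc p x, χ t = 0 ∨ t = p := by
        intro t ht
        rw [uIoc_of_ge h.le] at ht
        rcases eq_or_lt_of_le ht.2 with h3 | h3
        · exact Or.inr h3
        · exact Or.inl (hχ0 t fun hs => absurd (hp' t hs) (not_le.2 h3))
      have h4 : ∫ t in p..x, χ t = ∫ t in p..x, (0 : ℝ) := by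
        apply intervalIntegral.integral_congr_ae
        have : ∀ᵐ t : ℝ, t ≠ p := by simp [ae_iff, measure_singleton]
        filter_upwards [this] with t h5 h6
        exact (‹∀ t ∈ uIoc p x, χ t = 0 ∨ t = p› t h6).resolve_right h5
      simpa [Φ] using h4
    · have hqx : q < x := by
        by_contra h5
        exact hx ⟨h, not_lt.1 h5⟩
      have h6 : ∫ t in p..x, χ t = ∫ t, χ t := by
        rw [intervalIntegral.integral_of_le h, ← integral_Icc_eq_integral_Ioc]
        apply setIntegral_eq_integral_of_forall_compl_eq_zero
        intro t ht
        apply hχ0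
        intro hs
        exact ht ⟨hp' t hs, (hq' t hs).trans hqx.le⟩
      simp [Φ, h6, hχi]
  have hΦs : tsupport Φ ⊆ Icc p q := by
    apply closure_minimal _ isClosed_Icc
    intro x hx
    by_contra h
    exact hx (hΦz x h)
  have hΦc : HasCompactSupport Φ := isCompact_Icc.of_isClosed_subset (isClosed_tsupport _) hΦs
  have hz := h0 Φ hΦ hΦc (hΦs.trans fun x hx =>
    ⟨(hSs hpS).1.trans_le hx.1, hx.2.trans_lt (hSs hqS).2⟩)
  rw [hΦd'] at hz
  have hd' : ∫ x in Ioo (0 : ℝ) 1, η x = d :=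
    setIntegral_eq_integral_of_forall_compl_eq_zero fun x hx =>
      image_eq_zero_of_notMem_tsupport fun h => hx (hηs h)
  have i1 := integrable_mul_test hh hη.continuous hηc
  have i2 := integrable_mul_test hh hψ.continuous hψc
  have e1 : ∫ x in Ioo (0 : ℝ) 1, h x * χ x
      = (∫ x in Ioo (0 : ℝ) 1, h x * η x) - d * c := by
    rw [hc, ← integral_const_mul, ← integral_sub i1 (i2.const_mul d)]
    congr 1; ext x; simp only [χ]; ring
  have e2 : ∫ x in Ioo (0 : ℝ) 1, η x • (h x - c)
      = (∫ x in Ioo (0 : ℝ) 1, h x * η x) - c * d := by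
    rw [← hd', ← integral_const_mul, ← integral_sub i1
      (((hη.continuous.integrable_of_hasCompactSupport hηc).integrableOn).const_mul c)]
    congr 1; ext x; simp only [smul_eq_mul]; ring
  rw [e2]; rw [e1] at hz; linarith

theorem setIntegral_eq_interval (F : ℝ → ℝ) :
    ∫ x in Ioo (0 : ℝ) 1, F x = ∫ x in (0 : ℝ)..1, F x := by
  rw [intervalIntegral.integral_of_le zero_le_one, integral_Ioc_eq_integral_Ioo]

theorem ae_unit_of_ae {P : ℝ → Prop} (h : ∀ᵐ x : ℝ, x ∈ uIcc (0 : ℝ) 1 → P x) :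
    ∀ᵐ x ∂unitMeasure, P x := by
  rw [ae_restrict_iff' measurableSet_Ioo]
  filter_upwards [h] with x hx hx'
  exact hx (by rw [uIcc_of_le zero_le_one]; exact Ioo_subset_Icc_self hx')

theorem test_zero {φ : ℝ → ℝ} (hs : tsupport φ ⊆ Ioo (0 : ℝ) 1) : φ 0 = 0 ∧ φ 1 = 0 :=
  ⟨image_eq_zero_of_notMem_tsupport fun h => lt_irrefl _ (hs h).1,
    image_eq_zero_of_notMem_tsupport fun h => lt_irrefl _ (hs h).2⟩

/-- Integration by parts of an absolutely continuous function against a test function. -/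
theorem integral_ac_mul_deriv {F φ : ℝ → ℝ} (hF : AbsolutelyContinuousOnInterval F 0 1)
    (h1 : ContDiff ℝ ∞ φ) (h3 : tsupport φ ⊆ Ioo (0 : ℝ) 1) :
    ∫ x in Ioo (0 : ℝ) 1, F x * deriv φ x = - ∫ x in Ioo (0 : ℝ) 1, deriv F x * φ x := by
  have hφ : AbsolutelyContinuousOnInterval φ 0 1 :=
    (h1.of_le (by norm_num)).contDiffOn.absolutelyContinuousOnInterval
  rw [setIntegral_eq_interval, setIntegral_eq_interval, hF.integral_mul_deriv_eq_deriv_mul hφ,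
    (test_zero h3).1, (test_zero h3).2]
  ring

theorem isWeakDeriv_of_ac {F : ℝ → ℝ} (hF : AbsolutelyContinuousOnInterval F 0 1) {f g : L2}
    (hf : f =ᵐ[unitMeasure] F) (hg : g =ᵐ[unitMeasure] deriv F) : IsWeakDeriv f g := by
  intro φ h1 _ h3
  rw [integral_congr_ae (g := fun x => F x * deriv φ x) (hf.mono fun x hx => by simp only [hx]),
    integral_ac_mul_deriv hF h1 h3]
  congr 1
  exact (integral_congr_ae (hg.mono fun x hx => by simp only [hx])).symm

theorem H1.exists_ac (f : H1) : ∃ F : ℝ → ℝ, AbsolutelyContinuousOnInterval F 0 1 ∧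
    f.toL2 =ᵐ[unitMeasure] F ∧ f.der =ᵐ[unitMeasure] deriv F := by
  let G : ℝ → ℝ := fun x => ∫ t in (0 : ℝ)..x, f.der t
  have hG : AbsolutelyContinuousOnInterval G 0 1 :=
    f.der.intervalIntegrable.absolutelyContinuousOnInterval_intervalIntegral (by simp)
  have hG' : ∀ᵐ x ∂unitMeasure, HasDerivAt G (f.der x) x := by
    apply ae_unit_of_ae
    filter_upwards [f.der.intervalIntegrable.ae_hasDerivAt_integral] with x hx hx'
    exact hx hx' 0 (by simp)
  have hGi : IntegrableOn G (Ioo (0 : ℝ) 1) volume := by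
    have := hG.continuousOn
    rw [uIcc_of_le zero_le_one] at this
    exact (this.integrableOn_Icc).mono_set Ioo_subset_Icc_self
  obtain ⟨c, hc⟩ := ae_const_of_integral_mul_deriv_eq_zero (h := fun x => f.toL2 x - G x)
    (f.toL2.integrable.sub hGi) (by
      intro φ h1 h2 h3
      have hd : Continuous (deriv φ) := h1.continuous_deriv (by norm_num)
      have e : ∫ x in Ioo (0 : ℝ) 1, deriv G x * φ x = ∫ x in Ioo (0 : ℝ) 1, f.der x * φ x :=
        integral_congr_ae (hG'.mono fun x hx => by simp only [hx.deriv])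
      have := f.isWeakDeriv φ h1 h2 h3
      simp only [sub_mul]
      rw [integral_sub (integrable_mul_test f.toL2.integrable hd h2.deriv)
        (integrable_mul_test hGi hd h2.deriv), this, integral_ac_mul_deriv hG h1 h3, e]
      ring)
  have hcac : AbsolutelyContinuousOnInterval (fun _ : ℝ => c) 0 1 :=
    contDiffOn_const.absolutelyContinuousOnInterval
  refine ⟨G + fun _ => c, hG.add hcac, ?_, ?_⟩
  · filter_upwards [hc] with x hx
    simp only [Pi.add_apply]; linarith
  · filter_upwards [hG'] with x hx
    exact ((hx.add_const c).deriv).symm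

/-- Every element of `H¹(0, 1)` has a representative that is continuous on `[0, 1]`. -/
theorem H1.exists_continuous_rep (f : H1) :
    ∃ F : ℝ → ℝ, ContinuousOn F (Icc 0 1) ∧ f.toL2 =ᵐ[unitMeasure] F := by
  obtain ⟨F, hF, h, _⟩ := f.exists_ac
  have := hF.continuousOn
  rw [uIcc_of_le zero_le_one] at this
  exact ⟨F, this, h⟩

/-- The continuous representative on `[0, 1]` of an element of `H¹(0, 1)` (its values outside
`[0, 1]` are never used); `f.rep 0` and `f.rep 1` are the boundary values. -/
def H1.rep (f : H1) : ℝ → ℝ := f.exists_continuous_rep.choose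

theorem H1.continuousOn_rep (f : H1) : ContinuousOn f.rep (Icc 0 1) :=
  f.exists_continuous_rep.choose_spec.1

theorem H1.toL2_ae_eq_rep (f : H1) : f.toL2 =ᵐ[unitMeasure] f.rep :=
  f.exists_continuous_rep.choose_spec.2

theorem eqOn_of_ae_eq_unit {F G : ℝ → ℝ} (h : F =ᵐ[unitMeasure] G)
    (hF : ContinuousOn F (Icc 0 1)) (hG : ContinuousOn G (Icc 0 1)) : EqOn F G (Icc 0 1) := by
  refine Measure.eqOn_Icc_of_ae_eq volume zero_ne_one ?_ hF hG
  rwa [← restrict_Ioo_eq_restrict_Icc]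

theorem H1.rep_eqOn {f : H1} {F : ℝ → ℝ} (hF : ContinuousOn F (Icc 0 1))
    (h : f.toL2 =ᵐ[unitMeasure] F) : EqOn f.rep F (Icc 0 1) :=
  eqOn_of_ae_eq_unit (f.toL2_ae_eq_rep.symm.trans h) f.continuousOn_rep hF

theorem H1.rep_add (f g : H1) : EqOn (f + g).rep (fun x => f.rep x + g.rep x) (Icc 0 1) := by
  apply H1.rep_eqOn (f.continuousOn_rep.add g.continuousOn_rep)
  rw [map_add]
  filter_upwards [Lp.coeFn_add f.toL2 g.toL2, f.toL2_ae_eq_rep, g.toL2_ae_eq_rep] with x h1 h2 h3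
  rw [h1, Pi.add_apply, h2, h3]; rfl

theorem H1.rep_smul (c : ℝ) (f : H1) : EqOn (c • f).rep (fun x => c * f.rep x) (Icc 0 1) := by
  apply H1.rep_eqOn (continuousOn_const.mul f.continuousOn_rep)
  rw [map_smul]
  filter_upwards [Lp.coeFn_smul c f.toL2, f.toL2_ae_eq_rep] with x h1 h2
  rw [h1, Pi.smul_apply, h2, smul_eq_mul]; rfl

/-- The trace `f ↦ f(0)` on `H¹(0, 1)`. -/
def H1.at0 : H1 →ₗ[ℝ] ℝ where
  toFun f := f.rep 0
  map_add' f g := H1.rep_add f g (by simp)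
  map_smul' c f := H1.rep_smul c f (by simp)

/-- The trace `f ↦ f(1)` on `H¹(0, 1)`. -/
def H1.at1 : H1 →ₗ[ℝ] ℝ where
  toFun f := f.rep 1
  map_add' f g := H1.rep_add f g (by simp)
  map_smul' c f := H1.rep_smul c f (by simp)

/-- The weak derivative is unique: an element of `H¹(0, 1)` is determined by its function. -/
theorem H1.toL2_injective : Function.Injective H1.toL2 := by
  rw [← LinearMap.ker_eq_bot, LinearMap.ker_eq_bot']
  intro f hf
  obtain ⟨F, hF, h1, h2⟩ := f.exists_ac
  have hF0 : EqOn F (fun _ => 0) (Icc 0 1) := by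
    have hFc := hF.continuousOn
    rw [uIcc_of_le zero_le_one] at hFc
    refine eqOn_of_ae_eq_unit ?_ hFc continuousOn_const
    rw [hf] at h1
    exact h1.symm.trans (Lp.coeFn_zero ℝ 2 unitMeasure)
  have hd : f.der = 0 := by
    rw [Lp.eq_zero_iff_ae_eq_zero]
    refine h2.trans ?_
    refine (ae_restrict_iff' measurableSet_Ioo).2 (ae_of_all _ fun x hx => ?_)
    have : F =ᶠ[𝓝 x] fun _ => 0 := by
      filter_upwards [Ioo_mem_nhds hx.1 hx.2] with t ht
      exact hF0 (Ioo_subset_Icc_self ht)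
    rw [this.deriv_eq]; simp
  apply Subtype.ext
  apply (WithLp.equiv 2 (L2 × L2)).injective
  exact Prod.ext hf hd

theorem memLp_mul_L2 {F : ℝ → ℝ} (hF : ContinuousOn F (Icc 0 1)) (g : L2) :
    MemLp (fun x => F x * g x) 2 unitMeasure := by
  obtain ⟨C, hC⟩ := isCompact_Icc.exists_bound_of_continuousOn hF
  have hm : AEStronglyMeasurable F unitMeasure :=
    (hF.mono Ioo_subset_Icc_self).aestronglyMeasurable measurableSet_Ioo
  refine (Lp.memLp g).of_le_mul (c := C) (hm.mul (Lp.memLp g).1) ?_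
  refine (ae_restrict_iff' measurableSet_Ioo).2 (ae_of_all _ fun x hx => ?_)
  rw [norm_mul]
  exact mul_le_mul_of_nonneg_right (hC x (Ioo_subset_Icc_self hx)) (norm_nonneg _)

/-- `H¹(0, 1)` is closed under products. -/
theorem H1.exists_mul (f g : H1) :
    ∃ h : H1, h.toL2 =ᵐ[unitMeasure] fun x => f.rep x * g.rep x := by
  obtain ⟨F, hF, hF1, hF2⟩ := f.exists_ac
  obtain ⟨G, hG, hG1, hG2⟩ := g.exists_ac
  have hFc := hF.continuousOn
  have hGc := hG.continuousOn
  rw [uIcc_of_le zero_le_one] at hFc hGc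
  have m1 : MemLp (fun x => F x * g.toL2 x) 2 unitMeasure := memLp_mul_L2 hFc g.toL2
  have m2 : MemLp (fun x => F x * g.der x + G x * f.der x) 2 unitMeasure :=
    (memLp_mul_L2 hFc g.der).add (memLp_mul_L2 hGc f.der)
  have hw : IsWeakDeriv (m1.toLp _) (m2.toLp _) := by
    refine isWeakDeriv_of_ac (hF.fun_mul hG) ?_ ?_
    · filter_upwards [m1.coeFn_toLp, hG1] with x h1 h2
      rw [h1, h2]
    · filter_upwards [m2.coeFn_toLp, hF2, hG2, ae_unit_of_ae hF.ae_differentiableAt,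
        ae_unit_of_ae hG.ae_differentiableAt] with x h1 h2 h3 h4 h5
      rw [h1, h2, h3, deriv_fun_mul h4 h5]; ring
  refine ⟨⟨WithLp.toLp 2 (m1.toLp _, m2.toLp _), hw⟩, ?_⟩
  change (m1.toLp _ : ℝ → ℝ) =ᵐ[unitMeasure] _
  filter_upwards [m1.coeFn_toLp, hF1, f.toL2_ae_eq_rep, g.toL2_ae_eq_rep] with x h1 h2 h3 h4
  rw [h1, ← h2, h3, h4]

/-- Multiplication by the coefficient `a ∈ H¹(0, 1)` on `H¹(0, 1)`. -/
def H1.mulLeft (a : H1) : H1 →ₗ[ℝ] H1 where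
  toFun f := (H1.exists_mul a f).choose
  map_add' f g := by
    apply H1.toL2_injective
    rw [map_add]
    apply Lp.ext
    filter_upwards [(H1.exists_mul a (f + g)).choose_spec, (H1.exists_mul a f).choose_spec,
      (H1.exists_mul a g).choose_spec, Lp.coeFn_add (H1.exists_mul a f).choose.toL2
      (H1.exists_mul a g).choose.toL2, ae_restrict_mem measurableSet_Ioo] with x h1 h2 h3 h4 h5
    rw [h1, h4, Pi.add_apply, h2, h3, H1.rep_add f g (Ioo_subset_Icc_self h5)]; ring
  map_smul' c f := by
    apply H1.toL2_injective
    rw [map_smul]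
    apply Lp.ext
    filter_upwards [(H1.exists_mul a (c • f)).choose_spec, (H1.exists_mul a f).choose_spec,
      Lp.coeFn_smul c (H1.exists_mul a f).choose.toL2,
      ae_restrict_mem measurableSet_Ioo] with x h1 h2 h3 h4
    rw [h1]
    simp only [RingHom.id_apply]
    rw [h3, Pi.smul_apply, h2, H1.rep_smul c f (Ioo_subset_Icc_self h4), smul_eq_mul]; ring

theorem H1.toL2_mulLeft (a f : H1) :
    (H1.mulLeft a f).toL2 =ᵐ[unitMeasure] fun x => a.rep x * f.rep x :=
  (H1.exists_mul a f).choose_spec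

/-- The inverse of the inclusion `H¹(0, 1) → L²(0, 1)` on its range. -/
def H1.lift : LinearMap.range H1.toL2 →ₗ[ℝ] H1 :=
  (LinearEquiv.ofInjective H1.toL2 H1.toL2_injective).symm.toLinearMap

theorem H1.toL2_lift (f : LinearMap.range H1.toL2) : (H1.lift f).toL2 = f :=
  congrArg Subtype.val ((LinearEquiv.ofInjective H1.toL2 H1.toL2_injective).apply_symm_apply f)

/-- The state space `H¹(0, 1) × L²(0, 1) × L²(0, 1) × ℝ²`. The product norm used here is the maximum
of the norms of the components; it is equivalent to the usual Hilbert norm of the product. -/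
abbrev StateSpace : Type := H1 × L2 × L2 × ℝ × ℝ

namespace StateSpace

abbrev y (Φ : StateSpace) : H1 := Φ.1
abbrev z (Φ : StateSpace) : L2 := Φ.2.1
abbrev u (Φ : StateSpace) : L2 := Φ.2.2.1
abbrev ξ (Φ : StateSpace) : ℝ := Φ.2.2.2.1
abbrev η (Φ : StateSpace) : ℝ := Φ.2.2.2.2

end StateSpace

/-- The domain `{(y, z, u, ξ, η) : y ∈ H², z, u ∈ H¹, ξ = u(0) = z(0), η = z(1)}`; the condition
`y ∈ H²` says that the weak derivative of `y` belongs to `H¹`. -/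
def craneDomain : Submodule ℝ StateSpace where
  carrier := {Φ | ∃ y' z u : H1, y'.toL2 = Φ.y.der ∧ z.toL2 = Φ.z ∧ u.toL2 = Φ.u ∧
    Φ.ξ = u.at0 ∧ u.at0 = z.at0 ∧ Φ.η = z.at1}
  add_mem' := by
    rintro Φ Ψ ⟨w, z, u, h1, h2, h3, h4, h5, h6⟩ ⟨w', z', u', h1', h2', h3', h4', h5', h6'⟩
    refine ⟨w + w', z + z', u + u', ?_, ?_, ?_, ?_, ?_, ?_⟩
    · rw [map_add, h1, h1']; exact (map_add H1.der _ _).symm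
    · rw [map_add, h2, h2']; rfl
    · rw [map_add, h3, h3']; rfl
    · rw [map_add, ← h4, ← h4']; rfl
    · rw [map_add, map_add, h5, h5']
    · rw [map_add, ← h6, ← h6']; rfl
  zero_mem' := by
    refine ⟨0, 0, 0, ?_, ?_, ?_, ?_, ?_, ?_⟩
    · rw [map_zero]; exact (map_zero H1.der).symm
    all_goals simp [StateSpace.z, StateSpace.u, StateSpace.ξ, StateSpace.η]
  smul_mem' := by
    rintro c Φ ⟨w, z, u, h1, h2, h3, h4, h5, h6⟩
    refine ⟨c • w, c • z, c • u, ?_, ?_, ?_, ?_, ?_, ?_⟩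
    · rw [map_smul, h1]; exact (map_smul H1.der _ _).symm
    · rw [map_smul, h2]; rfl
    · rw [map_smul, h3]; rfl
    · rw [map_smul, ← h4]; rfl
    · rw [map_smul, map_smul, h5]
    · rw [map_smul, ← h6]; rfl

/-- For a state in the domain, the derivative of `y` as an element of `H¹(0, 1)`. -/
def domY' : craneDomain →ₗ[ℝ] H1 :=
  H1.lift ∘ₗ LinearMap.codRestrict (LinearMap.range H1.toL2)
    (H1.der ∘ₗ LinearMap.fst ℝ H1 (L2 × L2 × ℝ × ℝ) ∘ₗ craneDomain.subtype)
    (fun Φ => by obtain ⟨w, _, _, h, _⟩ := Φ.2; exact ⟨w, h⟩)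

/-- For a state in the domain, the component `z` as an element of `H¹(0, 1)`. -/
def domZ : craneDomain →ₗ[ℝ] H1 :=
  H1.lift ∘ₗ LinearMap.codRestrict (LinearMap.range H1.toL2)
    (LinearMap.fst ℝ L2 (L2 × ℝ × ℝ) ∘ₗ LinearMap.snd ℝ H1 (L2 × L2 × ℝ × ℝ) ∘ₗ
      craneDomain.subtype)
    (fun Φ => by obtain ⟨_, z, _, _, h, _⟩ := Φ.2; exact ⟨z, h⟩)

/-- For a state in the domain, the component `u` as an element of `H¹(0, 1)`. -/
def domU : craneDomain →ₗ[ℝ] H1 :=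
  H1.lift ∘ₗ LinearMap.codRestrict (LinearMap.range H1.toL2)
    (LinearMap.fst ℝ L2 (ℝ × ℝ) ∘ₗ LinearMap.snd ℝ L2 (L2 × ℝ × ℝ) ∘ₗ
      LinearMap.snd ℝ H1 (L2 × L2 × ℝ × ℝ) ∘ₗ craneDomain.subtype)
    (fun Φ => by obtain ⟨_, _, u, _, _, h, _⟩ := Φ.2; exact ⟨u, h⟩)

theorem toL2_domY' (Φ : craneDomain) : (domY' Φ).toL2 = Φ.1.y.der := H1.toL2_lift _
theorem toL2_domZ (Φ : craneDomain) : (domZ Φ).toL2 = Φ.1.z := H1.toL2_lift _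
theorem toL2_domU (Φ : craneDomain) : (domU Φ).toL2 = Φ.1.u := H1.toL2_lift _

/-- The operator
`(y, z, u, ξ, η) ↦ (z, (a y')' - σ z, - u' / τ, ((a y')(0) + α u(1)) / m, - (a y')(1) / M)`. -/
def craneOperator (a : H1) (σ α τ m M : ℝ) : StateSpace →ₗ.[ℝ] StateSpace where
  domain := craneDomain
  toFun :=
    { toFun := fun Φ =>
        (domZ Φ,
         (H1.mulLeft a (domY' Φ)).der - σ • Φ.1.z,
         -(τ⁻¹ • (domU Φ).der),
         (1 / m) * ((H1.mulLeft a (domY' Φ)).at0 + α * (domU Φ).at1),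
         -((H1.mulLeft a (domY' Φ)).at1 / M))
      map_add' := by
        intro Φ Ψ
        simp only [map_add, Prod.mk_add_mk, Submodule.coe_add, StateSpace.z, Prod.snd_add,
          Prod.fst_add, smul_add, Prod.mk.injEq, true_and]
        refine ⟨by abel, by abel, by ring, by ring⟩
      map_smul' := by
        intro c Φ
        simp only [map_smul, Prod.smul_mk, Submodule.coe_smul, StateSpace.z, Prod.smul_snd,
          Prod.smul_fst, Prod.mk.injEq, true_and, RingHom.id_apply, smul_eq_mul]
        refine ⟨by module, by module, by ring, by ring⟩ }

/-- The functional `∫ (σ y + z) dx + m ξ + M η - α y(0) + τ α ∫ u dx`. -/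
def craneFunctional (σ α τ m M : ℝ) (Φ : StateSpace) : ℝ :=
  (∫ x in Ioo (0 : ℝ) 1, (σ * Φ.y.toL2 x + Φ.z x)) + m * Φ.ξ + M * Φ.η - α * Φ.y.at0
    + τ * α * ∫ x in Ioo (0 : ℝ) 1, Φ.u x

/-- The energy inner product of the state space. -/
def energyInner (a : H1) (σ α τ m M K ϖ : ℝ) (Φ Ψ : StateSpace) : ℝ :=
  (∫ x in Ioo (0 : ℝ) 1, (a.rep x * Φ.y.der x * Ψ.y.der x + Φ.z x * Ψ.z x))
    + K * τ * (∫ x in Ioo (0 : ℝ) 1, Φ.u x * Ψ.u x) + m * Φ.ξ * Ψ.ξ + M * Φ.η * Ψ.η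
    + ϖ * craneFunctional σ α τ m M Φ * craneFunctional σ α τ m M Ψ

theorem L2.ae_add (f g : L2) : ∀ᵐ x ∂unitMeasure, (f + g) x = f x + g x := Lp.coeFn_add f g

theorem L2.ae_smul (c : ℝ) (f : L2) : ∀ᵐ x ∂unitMeasure, (c • f) x = c * f x := by
  filter_upwards [Lp.coeFn_smul c f] with x hx
  rw [hx, Pi.smul_apply, smul_eq_mul]

theorem integrable_energy (a : H1) (f g h k : L2) :
    Integrable (fun x => a.rep x * f x * g x + h x * k x) unitMeasure :=
  ((memLp_mul_L2 a.continuousOn_rep f).integrable_mul (Lp.memLp g)).add (h.integrable_mul k)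

theorem craneFunctional_add (σ α τ m M : ℝ) (Φ Ψ : StateSpace) :
    craneFunctional σ α τ m M (Φ + Ψ)
      = craneFunctional σ α τ m M Φ + craneFunctional σ α τ m M Ψ := by
  have e1 : ∫ x in Ioo (0 : ℝ) 1, (σ * (Φ + Ψ).y.toL2 x + (Φ + Ψ).z x)
      = (∫ x in Ioo (0 : ℝ) 1, (σ * Φ.y.toL2 x + Φ.z x))
        + ∫ x in Ioo (0 : ℝ) 1, (σ * Ψ.y.toL2 x + Ψ.z x) := by
    have i : ∀ Θ : StateSpace, Integrable (fun x => σ * Θ.y.toL2 x + Θ.z x) unitMeasure :=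
      fun Θ => (Θ.y.toL2.integrable.const_mul σ).add Θ.z.integrable
    rw [← integral_add (i Φ) (i Ψ)]
    apply integral_congr_ae
    filter_upwards [L2.ae_add Φ.y.toL2 Ψ.y.toL2, L2.ae_add Φ.z Ψ.z] with x h1 h2
    rw [show (Φ + Ψ).y.toL2 = Φ.y.toL2 + Ψ.y.toL2 from rfl,
      show (Φ + Ψ).z = Φ.z + Ψ.z from rfl, h1, h2]
    ring
  have e2 : ∫ x in Ioo (0 : ℝ) 1, (Φ + Ψ).u x
      = (∫ x in Ioo (0 : ℝ) 1, Φ.u x) + ∫ x in Ioo (0 : ℝ) 1, Ψ.u x := by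
    rw [← integral_add Φ.u.integrable Ψ.u.integrable]
    exact integral_congr_ae (L2.ae_add Φ.u Ψ.u)
  unfold craneFunctional
  rw [e1, e2, show (Φ + Ψ).ξ = Φ.ξ + Ψ.ξ from rfl, show (Φ + Ψ).η = Φ.η + Ψ.η from rfl,
    show (Φ + Ψ).y.at0 = Φ.y.at0 + Ψ.y.at0 from map_add H1.at0 _ _]
  ring

theorem craneFunctional_smul (σ α τ m M c : ℝ) (Φ : StateSpace) :
    craneFunctional σ α τ m M (c • Φ) = c * craneFunctional σ α τ m M Φ := by
  have e1 : ∫ x in Ioo (0 : ℝ) 1, (σ * (c • Φ).y.toL2 x + (c • Φ).z x)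
      = c * ∫ x in Ioo (0 : ℝ) 1, (σ * Φ.y.toL2 x + Φ.z x) := by
    rw [← integral_const_mul]
    apply integral_congr_ae
    filter_upwards [L2.ae_smul c Φ.y.toL2, L2.ae_smul c Φ.z] with x h1 h2
    rw [show (c • Φ).y.toL2 = c • Φ.y.toL2 from rfl, show (c • Φ).z = c • Φ.z from rfl, h1, h2]
    ring
  have e2 : ∫ x in Ioo (0 : ℝ) 1, (c • Φ).u x = c * ∫ x in Ioo (0 : ℝ) 1, Φ.u x := by
    rw [← integral_const_mul]
    exact integral_congr_ae (L2.ae_smul c Φ.u)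
  unfold craneFunctional
  rw [e1, e2, show (c • Φ).ξ = c * Φ.ξ from rfl, show (c • Φ).η = c * Φ.η from rfl,
    show (c • Φ).y.at0 = c * Φ.y.at0 from map_smul H1.at0 _ _]
  ring

theorem energyInner_comm (a : H1) (σ α τ m M K ϖ : ℝ) (Φ Ψ : StateSpace) :
    energyInner a σ α τ m M K ϖ Φ Ψ = energyInner a σ α τ m M K ϖ Ψ Φ := by
  have e1 : (fun x => a.rep x * Φ.y.der x * Ψ.y.der x + Φ.z x * Ψ.z x)
      = fun x => a.rep x * Ψ.y.der x * Φ.y.der x + Ψ.z x * Φ.z x := by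
    ext x; ring
  have e2 : (fun x => Φ.u x * Ψ.u x) = fun x => Ψ.u x * Φ.u x := by
    ext x; ring
  unfold energyInner
  rw [e1, e2]; ring

theorem energyInner_add (a : H1) (σ α τ m M K ϖ : ℝ) (Φ Φ' Ψ : StateSpace) :
    energyInner a σ α τ m M K ϖ (Φ + Φ') Ψ
      = energyInner a σ α τ m M K ϖ Φ Ψ + energyInner a σ α τ m M K ϖ Φ' Ψ := by
  have e1 : ∫ x in Ioo (0 : ℝ) 1,
        (a.rep x * (Φ + Φ').y.der x * Ψ.y.der x + (Φ + Φ').z x * Ψ.z x)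
      = (∫ x in Ioo (0 : ℝ) 1, (a.rep x * Φ.y.der x * Ψ.y.der x + Φ.z x * Ψ.z x))
        + ∫ x in Ioo (0 : ℝ) 1, (a.rep x * Φ'.y.der x * Ψ.y.der x + Φ'.z x * Ψ.z x) := by
    rw [← integral_add (integrable_energy a _ _ _ _) (integrable_energy a _ _ _ _)]
    apply integral_congr_ae
    filter_upwards [L2.ae_add Φ.y.der Φ'.y.der, L2.ae_add Φ.z Φ'.z] with x h1 h2
    rw [show (Φ + Φ').y.der = Φ.y.der + Φ'.y.der from rfl,
      show (Φ + Φ').z = Φ.z + Φ'.z from rfl, h1, h2]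
    ring
  have e2 : ∫ x in Ioo (0 : ℝ) 1, (Φ + Φ').u x * Ψ.u x
      = (∫ x in Ioo (0 : ℝ) 1, Φ.u x * Ψ.u x) + ∫ x in Ioo (0 : ℝ) 1, Φ'.u x * Ψ.u x := by
    rw [← integral_add (Φ.u.integrable_mul _) (Φ'.u.integrable_mul _)]
    apply integral_congr_ae
    filter_upwards [L2.ae_add Φ.u Φ'.u] with x h1
    rw [show (Φ + Φ').u = Φ.u + Φ'.u from rfl, h1]; ring
  unfold energyInner
  rw [e1, e2, craneFunctional_add, show (Φ + Φ').ξ = Φ.ξ + Φ'.ξ from rfl,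
    show (Φ + Φ').η = Φ.η + Φ'.η from rfl]
  ring

theorem energyInner_smul (a : H1) (σ α τ m M K ϖ c : ℝ) (Φ Ψ : StateSpace) :
    energyInner a σ α τ m M K ϖ (c • Φ) Ψ = c * energyInner a σ α τ m M K ϖ Φ Ψ := by
  have e1 : ∫ x in Ioo (0 : ℝ) 1,
        (a.rep x * (c • Φ).y.der x * Ψ.y.der x + (c • Φ).z x * Ψ.z x)
      = c * ∫ x in Ioo (0 : ℝ) 1, (a.rep x * Φ.y.der x * Ψ.y.der x + Φ.z x * Ψ.z x) := by
    rw [← integral_const_mul]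
    apply integral_congr_ae
    filter_upwards [L2.ae_smul c Φ.y.der, L2.ae_smul c Φ.z] with x h1 h2
    rw [show (c • Φ).y.der = c • Φ.y.der from rfl, show (c • Φ).z = c • Φ.z from rfl, h1, h2]
    ring
  have e2 : ∫ x in Ioo (0 : ℝ) 1, (c • Φ).u x * Ψ.u x
      = c * ∫ x in Ioo (0 : ℝ) 1, Φ.u x * Ψ.u x := by
    rw [← integral_const_mul]
    apply integral_congr_ae
    filter_upwards [L2.ae_smul c Φ.u] with x h1
    rw [show (c • Φ).u = c • Φ.u from rfl, h1]; ring
  unfold energyInner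
  rw [e1, e2, craneFunctional_smul, show (c • Φ).ξ = c * Φ.ξ from rfl,
    show (c • Φ).η = c * Φ.η from rfl]
  ring

section Energy

variable {a : H1} {a₀ σ α τ m M K ϖ : ℝ}

theorem ae_unit_of_Icc {P : ℝ → Prop} (h : ∀ x ∈ Icc (0 : ℝ) 1, P x) : ∀ᵐ x ∂unitMeasure, P x :=
  (ae_restrict_iff' measurableSet_Ioo).2 (ae_of_all _ fun x hx => h x (Ioo_subset_Icc_self hx))

theorem ae_energy_nonneg (ha₀ : 0 < a₀) (ha : ∀ x ∈ Icc (0 : ℝ) 1, a₀ ≤ a.rep x)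
    (f h : L2) : 0 ≤ᵐ[unitMeasure] fun x => a.rep x * f x * f x + h x * h x := by
  filter_upwards [ae_unit_of_Icc ha] with x hx
  have : 0 ≤ a.rep x := ha₀.le.trans hx
  simp only [Pi.zero_apply]
  nlinarith [mul_nonneg this (mul_self_nonneg (f x)), mul_self_nonneg (h x)]

theorem energyInner_nonneg (ha₀ : 0 < a₀) (ha : ∀ x ∈ Icc (0 : ℝ) 1, a₀ ≤ a.rep x)
    (hτ : 0 < τ) (hm : 0 < m) (hM : 0 < M) (hK : 0 < K) (hϖ : 0 < ϖ) (Φ : StateSpace) :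
    0 ≤ energyInner a σ α τ m M K ϖ Φ Φ := by
  have i1 := integral_nonneg_of_ae (ae_energy_nonneg ha₀ ha Φ.y.der Φ.z)
  have i2 : 0 ≤ ∫ x in Ioo (0 : ℝ) 1, Φ.u x * Φ.u x :=
    integral_nonneg fun x => mul_self_nonneg _
  have i3 := mul_nonneg (mul_pos hK hτ).le i2
  have i4 := mul_nonneg hm.le (mul_self_nonneg Φ.ξ)
  have i5 := mul_nonneg hM.le (mul_self_nonneg Φ.η)
  have i6 := mul_nonneg hϖ.le (mul_self_nonneg (craneFunctional σ α τ m M Φ))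
  unfold energyInner
  nlinarith

theorem energyInner_definite (ha₀ : 0 < a₀) (ha : ∀ x ∈ Icc (0 : ℝ) 1, a₀ ≤ a.rep x)
    (hτ : 0 < τ) (hm : 0 < m) (hM : 0 < M) (hK : 0 < K) (hϖ : 0 < ϖ) (hσα : σ ≠ α)
    (Φ : StateSpace) (h0 : energyInner a σ α τ m M K ϖ Φ Φ = 0) : Φ = 0 := by
  have n1 := ae_energy_nonneg ha₀ ha Φ.y.der Φ.z
  have i1 := integral_nonneg_of_ae n1
  have n2 : 0 ≤ᵐ[unitMeasure] fun x => Φ.u x * Φ.u x := ae_of_all _ fun x => mul_self_nonneg _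
  have i2 := integral_nonneg_of_ae n2
  have i3 := mul_nonneg (mul_pos hK hτ).le i2
  have i4 := mul_nonneg hm.le (mul_self_nonneg Φ.ξ)
  have i5 := mul_nonneg hM.le (mul_self_nonneg Φ.η)
  have i6 := mul_nonneg hϖ.le (mul_self_nonneg (craneFunctional σ α τ m M Φ))
  unfold energyInner at h0
  have z1 : ∫ x in Ioo (0 : ℝ) 1, (a.rep x * Φ.y.der x * Φ.y.der x + Φ.z x * Φ.z x) = 0 := by
    linarith
  have z2 : ∫ x in Ioo (0 : ℝ) 1, Φ.u x * Φ.u x = 0 := by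
    have : K * τ * ∫ x in Ioo (0 : ℝ) 1, Φ.u x * Φ.u x = 0 := by linarith
    exact (mul_eq_zero.1 this).resolve_left (mul_pos hK hτ).ne'
  have z3 : Φ.ξ = 0 := by
    have : m * (Φ.ξ * Φ.ξ) = 0 := by linarith
    exact mul_self_eq_zero.1 ((mul_eq_zero.1 this).resolve_left hm.ne')
  have z4 : Φ.η = 0 := by
    have : M * (Φ.η * Φ.η) = 0 := by linarith
    exact mul_self_eq_zero.1 ((mul_eq_zero.1 this).resolve_left hM.ne')
  have z5 : craneFunctional σ α τ m M Φ = 0 := by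
    have : ϖ * (craneFunctional σ α τ m M Φ * craneFunctional σ α τ m M Φ) = 0 := by linarith
    exact mul_self_eq_zero.1 ((mul_eq_zero.1 this).resolve_left hϖ.ne')
  have ae1 := (integral_eq_zero_iff_of_nonneg_ae n1 (integrable_energy a _ _ _ _)).1 z1
  have ae2 := (integral_eq_zero_iff_of_nonneg_ae n2 (Φ.u.integrable_mul Φ.u)).1 z2
  have hu : Φ.u = 0 := by
    rw [Lp.eq_zero_iff_ae_eq_zero]
    exact ae2.mono fun x hx => mul_self_eq_zero.1 hx
  have hyz : ∀ᵐ x ∂unitMeasure, Φ.y.der x = 0 ∧ Φ.z x = 0 := by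
    filter_upwards [ae1, ae_unit_of_Icc ha] with x hx hax
    have hp : 0 < a.rep x := ha₀.trans_le hax
    have e1 := mul_nonneg hp.le (mul_self_nonneg (Φ.y.der x))
    have e2 := mul_self_nonneg (Φ.z x)
    simp only [Pi.zero_apply] at hx
    refine ⟨?_, mul_self_eq_zero.1 (by linarith)⟩
    have : a.rep x * (Φ.y.der x * Φ.y.der x) = 0 := by linarith
    exact mul_self_eq_zero.1 ((mul_eq_zero.1 this).resolve_left hp.ne')
  have hz : Φ.z = 0 := by
    rw [Lp.eq_zero_iff_ae_eq_zero]
    exact hyz.mono fun x hx => hx.2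
  obtain ⟨c, hc⟩ := ae_const_of_integral_mul_deriv_eq_zero Φ.y.toL2.integrable (by
    intro φ h1 h2 h3
    rw [Φ.y.isWeakDeriv φ h1 h2 h3, neg_eq_zero]
    exact integral_eq_zero_of_ae (hyz.mono fun x hx => by simp [hx.1]))
  have hc0 : Φ.y.at0 = c := H1.rep_eqOn continuousOn_const hc (by simp)
  have hI : ∫ x in Ioo (0 : ℝ) 1, (σ * Φ.y.toL2 x + Φ.z x) = σ * c := by
    rw [integral_congr_ae (g := fun _ => σ * c)]
    · simp
    · filter_upwards [hc, hyz] with x h1 h2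
      rw [h1, h2.2, add_zero]
  have hU : ∫ x in Ioo (0 : ℝ) 1, Φ.u x = 0 :=
    integral_eq_zero_of_ae (ae2.mono fun x hx => mul_self_eq_zero.1 hx)
  unfold craneFunctional at z5
  rw [hI, hU, z3, z4, hc0] at z5
  have hcz : c = 0 := by
    have : (σ - α) * c = 0 := by linarith
    exact (mul_eq_zero.1 this).resolve_left (sub_ne_zero.2 hσα)
  have hy : Φ.y = 0 := by
    apply H1.toL2_injective
    rw [map_zero, Lp.eq_zero_iff_ae_eq_zero]
    rw [hcz] at hc
    exact hc
  exact Prod.ext hy (Prod.ext hz (Prod.ext hu (Prod.ext z3 z4)))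

/-- The energy inner product is a genuine inner product when `σ ≠ α`. -/
@[reducible] def energyCore (ha₀ : 0 < a₀) (ha : ∀ x ∈ Icc (0 : ℝ) 1, a₀ ≤ a.rep x)
    (hτ : 0 < τ) (hm : 0 < m) (hM : 0 < M) (hK : 0 < K) (hϖ : 0 < ϖ) (hσα : σ ≠ α) :
    InnerProductSpace.Core ℝ StateSpace where
  inner := energyInner a σ α τ m M K ϖ
  conj_inner_symm Φ Ψ := by
    rw [conj_trivial]; exact energyInner_comm a σ α τ m M K ϖ Ψ Φ
  re_inner_nonneg Φ := energyInner_nonneg ha₀ ha hτ hm hM hK hϖ Φ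
  add_left := energyInner_add a σ α τ m M K ϖ
  smul_left Φ Ψ c := by
    rw [conj_trivial]; exact energyInner_smul a σ α τ m M K ϖ c Φ Ψ
  definite := energyInner_definite ha₀ ha hτ hm hM hK hϖ hσα

end Energy

/-- The vector space `V`, equipped with the inner product `c` and the norm it induces. -/
def WithInner {V : Type*} [AddCommGroup V] [Module ℝ V] (_c : InnerProductSpace.Core ℝ V) :
    Type _ := V

namespace WithInner

variable {V : Type*} [AddCommGroup V] [Module ℝ V] (c : InnerProductSpace.Core ℝ V)

instance : NormedAddCommGroup (WithInner c) :=
  @InnerProductSpace.Core.toNormedAddCommGroup ℝ V _ _ _ c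

instance : InnerProductSpace ℝ (WithInner c) :=
  @InnerProductSpace.ofCore ℝ V _ _ _ c.toCore

/-- The identity map `V → WithInner c`. -/
def of : V ≃ₗ[ℝ] WithInner c where
  toFun x := x
  invFun x := x
  map_add' _ _ := rfl
  map_smul' _ _ := rfl
  left_inv _ := rfl
  right_inv _ := rfl

/-- An unbounded operator in `V`, seen as an operator in `WithInner c`. -/
def operator (A : V →ₗ.[ℝ] V) : WithInner c →ₗ.[ℝ] WithInner c where
  domain := A.domain.comap (of c).symm.toLinearMap
  toFun :=
    { toFun := fun x => of c (A ⟨(of c).symm x, x.2⟩)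
      map_add' := fun x y => by
        rw [← map_add, ← A.map_add]
        rfl
      map_smul' := fun r x => by
        rw [RingHom.id_apply, ← map_smul, ← A.map_smul]
        rfl }

/-- The norm induced by the inner product `c` is equivalent to the given norm of `V`. -/
def NormEquivalent {V : Type*} [NormedAddCommGroup V] [NormedSpace ℝ V]
    (c : InnerProductSpace.Core ℝ V) : Prop :=
  ∃ C₁ C₂ : ℝ, 0 < C₁ ∧ 0 < C₂ ∧ ∀ v : V, C₁ * ‖v‖ ≤ ‖of c v‖ ∧ ‖of c v‖ ≤ C₂ * ‖v‖

end WithInner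

section Semigroups

variable {X : Type*} [NormedAddCommGroup X] [NormedSpace ℝ X]

/-- A `C₀`-semigroup of bounded linear operators `S t`, `t ≥ 0` (the values of `S` at negative
times are irrelevant). -/
structure IsC0Semigroup (S : ℝ → X →L[ℝ] X) : Prop where
  map_zero : S 0 = ContinuousLinearMap.id ℝ X
  map_add : ∀ s t : ℝ, 0 ≤ s → 0 ≤ t → S (s + t) = (S s).comp (S t)
  tendsto_zero : ∀ x : X, Tendsto (fun t => S t x) (𝓝[>] 0) (𝓝 x)

/-- `A` is the infinitesimal generator of `S`: its domain consists of exactly those `x` for which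
`(S h x - x) / h` has a limit as `h → 0+`, and `A x` is that limit. -/
def IsGenerator (A : X →ₗ.[ℝ] X) (S : ℝ → X →L[ℝ] X) : Prop :=
  ∀ x y : X, (x, y) ∈ A.graph ↔ Tendsto (fun h : ℝ => h⁻¹ • (S h x - x)) (𝓝[>] 0) (𝓝 y)

/-- `Φ` is a strong (classical) solution of `Φ' = A Φ` on `[0, ∞)` with `Φ(0) = Φ₀`, of class
`C([0, ∞); D(A)) ∩ C¹([0, ∞); X)`, where `D(A)` carries the graph norm. -/
structure IsStrongSolution (A : X →ₗ.[ℝ] X) (Φ₀ : X) (Φ : ℝ → X) : Prop where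
  initial : Φ 0 = Φ₀
  mem_domain : ∀ t : ℝ, 0 ≤ t → Φ t ∈ A.domain
  contDiffOn : ContDiffOn ℝ 1 Φ (Ici 0)
  continuous_apply : Continuous fun t : Ici (0 : ℝ) => A ⟨Φ t, mem_domain t t.2⟩
  hasDerivWithinAt : ∀ (t : ℝ) (ht : 0 ≤ t),
    HasDerivWithinAt Φ (A ⟨Φ t, mem_domain t ht⟩) (Ici 0) t

/-- `Φ` is a mild solution of `Φ' = A Φ` on `[0, ∞)` with `Φ(0) = Φ₀`: it is continuous and, for
all `t ≥ 0`, the integral of `Φ` over `[0, t]` lies in `D(A)` and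
`Φ(t) = Φ₀ + A (∫ s in 0..t, Φ(s))`. -/
structure IsMildSolution (A : X →ₗ.[ℝ] X) (Φ₀ : X) (Φ : ℝ → X) : Prop where
  continuousOn : ContinuousOn Φ (Ici 0)
  integral_mem_graph : ∀ t : ℝ, 0 ≤ t → (∫ s in (0 : ℝ)..t, Φ s, Φ t - Φ₀) ∈ A.graph

/-- `A` is densely defined and generates a `C₀`-semigroup; for initial data in the domain of `A`
the orbit of the semigroup is the unique strong solution of `Φ' = A Φ`, and for arbitrary initial
data it is the unique mild solution. -/
def IsWellPosed (A : X →ₗ.[ℝ] X) : Prop :=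
  Dense (A.domain : Set X) ∧
  ∃ S : ℝ → X →L[ℝ] X, IsC0Semigroup S ∧ IsGenerator A S ∧
    (∀ Φ₀ ∈ A.domain, IsStrongSolution A Φ₀ (fun t => S t Φ₀) ∧
      ∀ Ψ : ℝ → X, IsStrongSolution A Φ₀ Ψ → EqOn Ψ (fun t => S t Φ₀) (Ici 0)) ∧
    (∀ Φ₀ : X, IsMildSolution A Φ₀ (fun t => S t Φ₀) ∧
      ∀ Ψ : ℝ → X, IsMildSolution A Φ₀ Ψ → EqOn Ψ (fun t => S t Φ₀) (Ici 0))

end Semigroups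

end Crane

end

/-! Well-posedness in the sense of `IsWellPosed` depends only on the topology of the space, so it
may be proved in any equivalent Hilbert norm and carried elsewhere along a linear homeomorphism
(`isWellPosed_operator_iff`). The norm chosen for the proof is an energy norm with `K = ϖ = 1` in
which the functional `ℓ` carries `α + 1` in place of `σ`. Its definiteness needs that parameter to
differ from `α`, which now always holds, so part (A) covers `σ = α` as well. Part (B) is then the
same well-posedness seen through another equivalent norm.

In the auxiliary norm the operator is quasi-dissipative (`energyInner_craneOperator_le`).
Integration by parts cancels the wave energy flux at both ends against the kinetic terms `m ξ` and
`M η`. The delay contributes a quadratic form in `u(1)` and `ξ`, controlled by `ξ²`, and `ℓ` of the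
operator is a multiple of the mean of `z`, hence controlled by the energy. Exponential growth is
harmless, since only a `C₀`-semigroup is sought and not a contraction semigroup.

For `l > α / m` the map `l - A` is onto (`craneOperator_range`). Solving the transport equation for
`u` explicitly and eliminating `z`, `ξ`, `η` leaves a Robin problem for `y`, coercive on `H¹`, which
is solved by Lax–Milgram (`exists_elliptic`).

The Lumer–Phillips theorem (`IsQuasiDissipative.isWellPosed`) does the rest. The semigroup is the
strong limit of exponentials of Yosida approximations, and uniqueness of strong and mild solutions
follows from the energy estimate. -/

open MeasureTheory Set Filter Topology
open scoped ContDiff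

noncomputable section

namespace Crane

/-! ### Quasi-dissipative operators: growth estimate, resolvent, density of the domain -/

section Dissipative

variable {H : Type*} [NormedAddCommGroup H] [InnerProductSpace ℝ H]

/-- Energy estimate: if `⟪w', w⟫ ≤ c ‖w‖²` along a differentiable curve, then `‖w‖` grows at most
like `exp (c t)`. -/
theorem norm_le_exp_of_inner_deriv_le {w w' : ℝ → H} {c : ℝ}
    (hw : ∀ t, 0 ≤ t → HasDerivWithinAt w (w' t) (Ici 0) t)
    (h : ∀ t, 0 ≤ t → inner ℝ (w' t) (w t) ≤ c * ‖w t‖ ^ 2) {t : ℝ} (ht : 0 ≤ t) :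
    ‖w t‖ ≤ Real.exp (c * t) * ‖w 0‖ := by
  -- Integrating factor: the hypothesis says exactly that this function has nonpositive derivative.
  let f : ℝ → ℝ := fun t => Real.exp (-2 * c * t) * ‖w t‖ ^ 2
  have hf : ∀ t, 0 ≤ t → HasDerivWithinAt f
      (Real.exp (-2 * c * t) * (2 * (inner ℝ (w' t) (w t) - c * ‖w t‖ ^ 2))) (Ici 0) t := by
    intro t ht
    have h1 : HasDerivWithinAt (fun t : ℝ => Real.exp (-2 * c * t))
        (Real.exp (-2 * c * t) * (-2 * c)) (Ici 0) t := by
      have := ((hasDerivAt_id t).const_mul (-2 * c)).exp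
      simpa using this.hasDerivWithinAt
    have h2 := (hw t ht).norm_sq
    refine (h1.mul h2).congr_deriv ?_
    rw [real_inner_comm]
    ring
  have hanti : AntitoneOn f (Ici 0) := by
    apply antitoneOn_of_deriv_nonpos (convex_Ici 0) (fun t ht => (hf t ht).continuousWithinAt)
    · intro t ht
      rw [interior_Ici] at ht ⊢
      exact ((hf t (le_of_lt ht)).mono Ioi_subset_Ici_self).differentiableWithinAt
    · intro t ht
      rw [interior_Ici] at ht
      rw [((hf t (le_of_lt ht)).hasDerivAt (Ici_mem_nhds ht)).deriv]
      have := h t (le_of_lt ht)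
      exact mul_nonpos_of_nonneg_of_nonpos (Real.exp_pos _).le (by linarith)
  have key : f t ≤ f 0 := hanti (mem_Ici.2 le_rfl) (mem_Ici.2 ht) ht
  simp only [f, mul_zero, Real.exp_zero, one_mul] at key
  refine abs_le_of_sq_le_sq' ?_ (by positivity) |>.2
  have e : Real.exp (c * t) ^ 2 * Real.exp (-2 * c * t) = 1 := by
    rw [← Real.exp_nat_mul, ← Real.exp_add, Real.exp_eq_one_iff]; push_cast; ring
  calc ‖w t‖ ^ 2 = Real.exp (c * t) ^ 2 * (Real.exp (-2 * c * t) * ‖w t‖ ^ 2) := by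
        rw [← mul_assoc, e, one_mul]
    _ ≤ Real.exp (c * t) ^ 2 * ‖w 0‖ ^ 2 := by gcongr
    _ = _ := by ring

/-- The operator `A - κ` is dissipative. -/
def IsQuasiDissipative (A : H →ₗ.[ℝ] H) (κ : ℝ) : Prop :=
  ∀ x : A.domain, inner ℝ (A x) (x : H) ≤ κ * ‖(x : H)‖ ^ 2

theorem IsQuasiDissipative.inner_le {A : H →ₗ.[ℝ] H} {κ : ℝ} (hA : IsQuasiDissipative A κ)
    {x y : H} (h : (x, y) ∈ A.graph) : inner ℝ y x ≤ κ * ‖x‖ ^ 2 := by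
  obtain ⟨z, rfl, rfl⟩ := (A.mem_graph_iff).1 h
  exact hA z

/-- Pairing `lam • x - y` with `x` gives `(lam - κ) ‖x‖² ≤ ‖lam • x - y‖ ‖x‖`, and one factor `‖x‖`
cancels. -/
theorem IsQuasiDissipative.norm_le {A : H →ₗ.[ℝ] H} {κ lam : ℝ} (hA : IsQuasiDissipative A κ)
    (hl : κ < lam) {x y : H} (h : (x, y) ∈ A.graph) :
    ‖x‖ ≤ (lam - κ)⁻¹ * ‖lam • x - y‖ := by
  have h1 := hA.inner_le h
  have h2 : inner ℝ (lam • x - y) x = lam * ‖x‖ ^ 2 - inner ℝ y x := by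
    rw [inner_sub_left, inner_smul_left, real_inner_self_eq_norm_sq]; rfl
  have h3 := real_inner_le_norm (lam • x - y) x
  have hp : 0 < lam - κ := sub_pos.2 hl
  rw [inv_mul_eq_div, le_div_iff₀ hp]
  rcases eq_or_lt_of_le (norm_nonneg x) with h0 | h0
  · rw [← h0, zero_mul]; exact norm_nonneg _
  · refine le_of_mul_le_mul_right ?_ h0
    nlinarith

/-- `R` is the resolvent `(lam - A)⁻¹`. -/
def IsResolvent {X : Type*} [NormedAddCommGroup X] [NormedSpace ℝ X] (A : X →ₗ.[ℝ] X) (lam : ℝ)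
    (R : X →L[ℝ] X) : Prop :=
  ∀ x y : X, (x, y) ∈ A.graph ↔ R (lam • x - y) = x

/-- The a priori bound makes `lam - A` injective. Hence the chosen preimages depend linearly on the
datum, and the same bound makes this dependence continuous. -/
theorem IsQuasiDissipative.exists_resolvent {A : H →ₗ.[ℝ] H} {κ lam : ℝ}
    (hA : IsQuasiDissipative A κ) (hl : κ < lam)
    (hr : ∀ y : H, ∃ x : A.domain, lam • (x : H) - A x = y) :
    ∃ R : H →L[ℝ] H, IsResolvent A lam R ∧ ∀ y, ‖R y‖ ≤ (lam - κ)⁻¹ * ‖y‖ := by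
  have hinj : ∀ {x y x' y' : H}, (x, y) ∈ A.graph → (x', y') ∈ A.graph →
      lam • x - y = lam • x' - y' → x = x' := by
    intro x y x' y' h h' e
    have hs : (x - x', y - y') ∈ A.graph := A.graph.sub_mem h h'
    have := hA.norm_le hl hs
    rw [show lam • (x - x') - (y - y') = (lam • x - y) - (lam • x' - y') by module, e, sub_self,
      norm_zero, mul_zero] at this
    exact sub_eq_zero.1 (norm_le_zero_iff.1 this)
  choose r hr using hr
  have hg : ∀ y, ((r y : H), A (r y)) ∈ A.graph := fun y => A.mem_graph _
  let R₀ : H →ₗ[ℝ] H :=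
    { toFun := fun y => r y
      map_add' := fun y y' => by
        refine hinj (hg _) (A.graph.add_mem (hg y) (hg y')) ?_
        rw [hr, show lam • ((r y : H) + r y') - (A (r y) + A (r y'))
          = (lam • (r y : H) - A (r y)) + (lam • (r y' : H) - A (r y')) by module, hr, hr]
      map_smul' := fun c y => by
        refine hinj (hg _) (A.graph.smul_mem c (hg y)) ?_
        rw [hr, RingHom.id_apply, show lam • c • (r y : H) - c • A (r y)
          = c • (lam • (r y : H) - A (r y)) by module, hr] }
  have hb : ∀ y, ‖R₀ y‖ ≤ (lam - κ)⁻¹ * ‖y‖ := by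
    intro y
    have := hA.norm_le hl (hg y)
    rwa [hr] at this
  refine ⟨R₀.mkContinuous _ hb, ?_, hb⟩
  intro x y
  constructor
  · intro h
    exact hinj (hg _) h (hr _)
  · intro h
    have h' : (r (lam • x - y) : H) = x := h
    have h2 := hr (lam • x - y)
    have h3 := hg (lam • x - y)
    rw [h'] at h2 h3
    have : A (r (lam • x - y)) = y := by
      rwa [sub_right_inj] at h2
    rwa [this] at h3

/-- A vector orthogonal to the domain has the form `lam • x - A x`. Pairing it with `x` itself gives
`(lam - κ) ‖x‖² ≤ 0`, so it vanishes. -/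
theorem IsQuasiDissipative.dense_domain [CompleteSpace H] {A : H →ₗ.[ℝ] H} {κ lam : ℝ}
    (hA : IsQuasiDissipative A κ) (hl : κ < lam)
    (hr : ∀ y : H, ∃ x : A.domain, lam • (x : H) - A x = y) : Dense (A.domain : Set H) := by
  rw [Submodule.dense_iff_topologicalClosure_eq_top, Submodule.topologicalClosure_eq_top_iff,
    Submodule.eq_bot_iff]
  intro w hw
  obtain ⟨x, rfl⟩ := hr w
  have h1 : inner ℝ (x : H) (lam • (x : H) - A x) = 0 := hw x x.2
  rw [inner_sub_right, inner_smul_right, real_inner_self_eq_norm_sq, real_inner_comm] at h1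
  have h2 := hA x
  have h3 : ‖(x : H)‖ ^ 2 = 0 := by
    have := sq_nonneg ‖(x : H)‖
    nlinarith
  have h4 : x = 0 := Subtype.ext (norm_eq_zero.1 (pow_eq_zero_iff two_ne_zero |>.1 h3))
  simp [h4]

end Dissipative

/-! ### Algebra of resolvents -/

section Resolvent

variable {X : Type*} [NormedAddCommGroup X] [NormedSpace ℝ X] {A : X →ₗ.[ℝ] X} {lam mu : ℝ}
  {R R' : X →L[ℝ] X}

theorem IsResolvent.mem_graph (hR : IsResolvent A lam R) (y : X) :
    (R y, lam • R y - y) ∈ A.graph := by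
  rw [hR]; congr 1; abel

/-- The resolvent equivalence exhibits the graph as the set where two continuous maps agree. -/
theorem IsResolvent.isClosed_graph (hR : IsResolvent A lam R) :
    IsClosed (A.graph : Set (X × X)) := by
  have : (A.graph : Set (X × X)) = {p | R (lam • p.1 - p.2) = p.1} := by
    ext p; exact hR p.1 p.2
  rw [this]
  exact isClosed_eq (by fun_prop) continuous_fst

/-- The resolvent identity, read off by applying the characterisation of `R'` to the graph point `(R
y, lam • R y - y)`. -/
theorem IsResolvent.sub (hR : IsResolvent A lam R) (hR' : IsResolvent A mu R') (y : X) :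
    R y - R' y = (mu - lam) • R' (R y) := by
  have h := (hR' _ _).1 (hR.mem_graph y)
  rw [show mu • R y - (lam • R y - y) = (mu - lam) • R y + y by module, map_add, map_smul] at h
  rw [sub_eq_iff_eq_add]; exact h.symm

/-- Writing the resolvent identity in both orders shows that `mu - lam` annihilates the commutator.
-/
theorem IsResolvent.comm (hR : IsResolvent A lam R) (hR' : IsResolvent A mu R') (hne : lam ≠ mu) :
    Commute R R' := by
  ext y
  have h1 := hR.sub hR' y
  have h2 := hR'.sub hR y
  have h3 : (mu - lam) • (R (R' y) - R' (R y)) = 0 := by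
    rw [smul_sub, ← h1, show (mu - lam) • R (R' y) = -((lam - mu) • R (R' y)) by module, ← h2]
    abel
  exact sub_eq_zero.1 ((smul_eq_zero.1 h3).resolve_left (sub_ne_zero.2 hne.symm))

end Resolvent

/-! ### Strong limits of exponentials of bounded operators -/

section Limit

variable {H : Type*} [NormedAddCommGroup H] [InnerProductSpace ℝ H] [CompleteSpace H]

open NormedSpace in
theorem hasDerivAt_exp_smul_apply (B : H →L[ℝ] H) (x : H) (t : ℝ) :
    HasDerivAt (fun s : ℝ => exp (s • B) x) (B (exp (t • B) x)) t :=
  (hasDerivAt_exp_smul_const' B t).clm_apply (hasDerivAt_const t x) |>.congr_deriv (by simp)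

open NormedSpace in
theorem norm_exp_smul_apply_le {B : H →L[ℝ] H} {c : ℝ}
    (hB : ∀ x, inner ℝ (B x) x ≤ c * ‖x‖ ^ 2) {t : ℝ} (ht : 0 ≤ t) (x : H) :
    ‖exp (t • B) x‖ ≤ Real.exp (c * t) * ‖x‖ := by
  have := norm_le_exp_of_inner_deriv_le (w := fun s : ℝ => exp (s • B) x)
    (fun s _ => (hasDerivAt_exp_smul_apply B x s).hasDerivWithinAt) (fun s _ => hB _) ht
  simpa using this

open NormedSpace in
-- Duhamel interpolation: the curve `exp ((t - s) • C) (exp (s • B) x)` runs from `exp (t • C) x` to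
-- `exp (t • B) x`. Because `B` and `C` commute, its velocity is the product of the two exponentials
-- applied to `B x - C x`, and the growth factors combine to `exp (c t)`.
theorem norm_exp_smul_sub_le {B C : H →L[ℝ] H} {c : ℝ} (hBC : Commute B C)
    (hB : ∀ x, inner ℝ (B x) x ≤ c * ‖x‖ ^ 2) (hC : ∀ x, inner ℝ (C x) x ≤ c * ‖x‖ ^ 2)
    {t : ℝ} (ht : 0 ≤ t) (x : H) :
    ‖exp (t • B) x - exp (t • C) x‖ ≤ t * Real.exp (c * t) * ‖B x - C x‖ := by
  have hd : ∀ s ∈ Icc (0 : ℝ) t, HasDerivWithinAt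
      (fun s : ℝ => exp ((t - s) • C) (exp (s • B) x))
      (exp ((t - s) • C) (exp (s • B) (B x - C x))) (Icc 0 t) s := by
    intro s hs
    have h1 : HasDerivAt (fun s : ℝ => exp ((t - s) • C))
        (-(exp ((t - s) • C) * C)) s := by
      have := (hasDerivAt_exp_smul_const C (t - s)).scomp s ((hasDerivAt_id s).const_sub t)
      rw [neg_one_smul] at this
      exact this
    have h2 := h1.clm_apply (hasDerivAt_exp_smul_apply B x s)
    refine (h2.congr_deriv ?_).hasDerivWithinAt
    have e1 : B (exp (s • B) x) = exp (s • B) (B x) :=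
      congrArg (fun T : H →L[ℝ] H => T x) ((Commute.refl B).smul_right s).exp_right.eq
    have e2 : C (exp (s • B) x) = exp (s • B) (C x) :=
      congrArg (fun T : H →L[ℝ] H => T x) (hBC.symm.smul_right s).exp_right.eq
    have e3 : (-(exp ((t - s) • C) * C)) (exp (s • B) x)
        = -(exp ((t - s) • C) (C (exp (s • B) x))) := rfl
    rw [e3, e1, e2, map_sub, map_sub]
    abel
  have hb : ∀ s ∈ Icc (0 : ℝ) t, ‖exp ((t - s) • C) (exp (s • B) (B x - C x))‖
      ≤ Real.exp (c * t) * ‖B x - C x‖ := by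
    intro s hs
    refine (norm_exp_smul_apply_le hC (sub_nonneg.2 hs.2) _).trans ?_
    calc _ ≤ Real.exp (c * (t - s)) * (Real.exp (c * s) * ‖B x - C x‖) := by
          gcongr; exact norm_exp_smul_apply_le hB hs.1 _
      _ = _ := by rw [← mul_assoc, ← Real.exp_add]; congr 2; ring
  have := (convex_Icc (0 : ℝ) t).norm_image_sub_le_of_norm_hasDerivWithin_le hd hb
    (left_mem_Icc.2 ht) (right_mem_Icc.2 ht)
  simp only [sub_self, sub_zero, zero_smul, exp_zero, one_apply_eq_self,
    Real.norm_of_nonneg ht] at this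
  linarith

open NormedSpace in
/-- Exponentials of commuting bounded operators that are uniformly quasi-dissipative and converge
on a dense set converge strongly, locally uniformly in time. -/
theorem exists_limit_exp {B : ℕ → H →L[ℝ] H} {c : ℝ} (hc : 0 ≤ c)
    (hB : ∀ n x, inner ℝ (B n x) x ≤ c * ‖x‖ ^ 2) (hcomm : ∀ i j, Commute (B i) (B j))
    {D : Set H} (hD : Dense D) (hcau : ∀ x ∈ D, CauchySeq fun n => B n x) :
    ∃ S : ℝ → H →L[ℝ] H,
      (∀ t, 0 ≤ t → ∀ x, Tendsto (fun n => exp (t • B n) x) atTop (𝓝 (S t x))) ∧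
      ∀ x, Continuous fun t => S t x := by
  have hucau : ∀ (T : ℝ) (x : H), 0 ≤ T →
      UniformCauchySeqOn (fun n t => exp (t • B n) x) atTop (Icc 0 T) := by
    intro T x hT
    rw [Metric.uniformCauchySeqOn_iff]
    intro ε hε
    set G := Real.exp (c * T) with hG
    have hGp : 0 < G := Real.exp_pos _
    -- Replacing `x` by `x'` costs less than `ε / 4` for each exponential; the Duhamel bound at `x'`
    -- costs at most `ε / 2`. The factor `T + 1` below keeps the tolerance meaningful when `T = 0`.
    obtain ⟨x', hx', hxx⟩ := hD.exists_dist_lt x (ε := ε / (4 * G)) (by positivity)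
    rw [dist_eq_norm] at hxx
    obtain ⟨N, hN⟩ := Metric.cauchySeq_iff.1 (hcau x' hx') (ε / (2 * (T + 1) * G)) (by positivity)
    refine ⟨N, fun i hi j hj t ht => ?_⟩
    have hij := hN i hi j hj
    rw [dist_eq_norm] at hij ⊢
    have hle : Real.exp (c * t) ≤ G := Real.exp_le_exp.2 (mul_le_mul_of_nonneg_left ht.2 hc)
    have h1 : ∀ k, ‖exp (t • B k) (x - x')‖ ≤ G * ‖x - x'‖ := fun k =>
      (norm_exp_smul_apply_le (hB k) ht.1 _).trans (by gcongr)
    have h2 : ‖exp (t • B i) x' - exp (t • B j) x'‖ ≤ T * G * ‖B i x' - B j x'‖ :=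
      (norm_exp_smul_sub_le (hcomm i j) (hB i) (hB j) ht.1 x').trans (by
        gcongr
        exact ht.2)
    have h3 : G * ‖x - x'‖ < ε / 4 := by
      calc _ < G * (ε / (4 * G)) := by gcongr
        _ = ε / 4 := by field_simp
    have h4 : T * G * ‖B i x' - B j x'‖ ≤ ε / 2 := by
      calc _ ≤ (T + 1) * G * (ε / (2 * (T + 1) * G)) := by gcongr; linarith
        _ = ε / 2 := by field_simp
    have e : exp (t • B i) x - exp (t • B j) x = exp (t • B i) (x - x')
        + (exp (t • B i) x' - exp (t • B j) x') - exp (t • B j) (x - x') := by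
      simp only [map_sub]; abel
    rw [e]
    refine (norm_sub_le _ _).trans_lt ?_
    have := norm_add_le (exp (t • B i) (x - x')) (exp (t • B i) x' - exp (t • B j) x')
    linarith [h1 i, h1 j]
  -- Negative times are frozen at `0`, which makes the orbits continuous on all of `ℝ` and not only
  -- on `[0, ∞)`.
  have hex : ∀ (t : ℝ) (x : H), ∃ y, Tendsto (fun n => exp (max t 0 • B n) x) atTop (𝓝 y) :=
    fun t x => cauchySeq_tendsto_of_complete
      ((hucau (max t 0) x (le_max_right _ _)).cauchySeq ⟨le_max_right _ _, le_rfl⟩)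
  choose s hs using hex
  let S : ℝ → H →L[ℝ] H := fun t =>
    continuousLinearMapOfTendsto (fun n => exp (max t 0 • B n)) (tendsto_pi_nhds.2 (hs t))
  have hS : ∀ t, 0 ≤ t → ∀ x, Tendsto (fun n => exp (t • B n) x) atTop (𝓝 (S t x)) := by
    intro t ht x
    have := hs t x
    rwa [max_eq_left ht] at this
  refine ⟨S, hS, fun x => ?_⟩
  have hon : ∀ T, 0 ≤ T → ContinuousOn (fun t => S t x) (Icc 0 T) := by
    intro T hT
    refine ((hucau T x hT).tendstoUniformlyOn_of_tendsto fun t ht => hS t ht.1 x).continuousOn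
      (Frequently.of_forall fun n => ?_)
    exact (continuous_iff_continuousAt.2 fun t =>
      (hasDerivAt_exp_smul_apply (B n) x t).continuousAt).continuousOn
  have hIci : ContinuousOn (fun t => S t x) (Ici 0) := by
    intro t ht
    have ht' : (0 : ℝ) ≤ t := ht
    refine (hon (t + 1) (by linarith) t ⟨ht', by linarith⟩).mono_of_mem_nhdsWithin ?_
    rw [← Ici_inter_Iic]
    exact inter_mem_nhdsWithin _ (Iic_mem_nhds (by linarith))
  have : (fun t => S t x) = fun t => S (max t 0) x := by
    ext1 t
    change s t x = s (max t 0) x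
    refine tendsto_nhds_unique (hs t x) ?_
    have := hs (max t 0) x
    rwa [max_eq_left (le_max_right t 0)] at this
  rw [this]
  exact hIci.comp_continuous (by fun_prop) fun t => mem_Ici.2 (le_max_right _ _)

end Limit

theorem apply_eq_of_mem_graph {X : Type*} [NormedAddCommGroup X] [NormedSpace ℝ X]
    {A : X →ₗ.[ℝ] X} {x y : X} (h : (x, y) ∈ A.graph) (hx : x ∈ A.domain) :
    A ⟨x, hx⟩ = y := by
  obtain ⟨v, h1, h2⟩ := A.mem_graph_iff.1 h
  rw [← show v = ⟨x, hx⟩ from Subtype.ext h1]; exact h2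

/-! ### Yosida approximation and the Lumer–Phillips theorem -/

section Generation

variable {H : Type*} [NormedAddCommGroup H] [InnerProductSpace ℝ H] {A : H →ₗ.[ℝ] H} {κ lam : ℝ}
  {R : H →L[ℝ] H}

/-- The Yosida approximation `lam A (lam - A)⁻¹`. -/
def yosida (lam : ℝ) (R : H →L[ℝ] H) : H →L[ℝ] H :=
  lam ^ 2 • R - lam • ContinuousLinearMap.id ℝ H

theorem yosida_apply (x : H) : yosida lam R x = lam ^ 2 • R x - lam • x := rfl

/-- The form is at most `lam² / (lam - κ) - lam = lam κ / (lam - κ)` times `‖x‖²`, and this factor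
is at most `2 κ` once `lam > 2 κ`. The bound is thus uniform in `lam`. -/
theorem inner_yosida_le (hκ : 0 ≤ κ) (hl : 2 * κ < lam)
    (hb : ∀ y, ‖R y‖ ≤ (lam - κ)⁻¹ * ‖y‖) (x : H) :
    inner ℝ (yosida lam R x) x ≤ 2 * κ * ‖x‖ ^ 2 := by
  have hp : 0 < lam - κ := by linarith
  have h1 : inner ℝ (R x) x ≤ (lam - κ)⁻¹ * ‖x‖ ^ 2 := by
    refine (real_inner_le_norm _ _).trans ?_
    have := mul_le_mul_of_nonneg_right (hb x) (norm_nonneg x)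
    linarith
  have h2 : lam ^ 2 * (lam - κ)⁻¹ - lam ≤ 2 * κ := by
    rw [← div_eq_mul_inv, sub_le_iff_le_add, div_le_iff₀ hp]
    nlinarith
  rw [yosida_apply, inner_sub_left, real_inner_smul_left, real_inner_smul_left,
    real_inner_self_eq_norm_sq]
  have h3 := mul_le_mul_of_nonneg_left h1 (sq_nonneg lam)
  have h4 := mul_le_mul_of_nonneg_right h2 (sq_nonneg ‖x‖)
  linarith

/-- On the domain, convergence of the Yosida approximations to `A` is thereby reduced to strong
convergence of `lam • R` to the identity. -/
theorem IsResolvent.yosida_eq (hR : IsResolvent A lam R) {x y : H} (h : (x, y) ∈ A.graph) :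
    yosida lam R x = lam • R y := by
  have := (hR x y).1 h
  rw [map_sub, map_smul, sub_eq_iff_eq_add] at this
  rw [yosida_apply, pow_two, mul_smul, this]
  module

theorem IsResolvent.commute_yosida {mu : ℝ} {R' : H →L[ℝ] H} (h : Commute R R') :
    Commute (yosida lam R) (yosida mu R') := by
  have h1 : ∀ T : H →L[ℝ] H, Commute T (ContinuousLinearMap.id ℝ H) := fun T => Commute.one_right T
  unfold yosida
  exact (((h.smul_left _).smul_right _).sub_right ((h1 _).smul_right _)).sub_left
    (((h1 _).symm.smul_left _).smul_right _ |>.sub_right (((h1 _).smul_left _).smul_right _))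

/-- For `y'` in the domain, `l n • R n y' - y' = R n (A y')` is of size `(l n - κ)⁻¹`. The uniform
bound `2` on the norms of `l n • R n` extends the convergence from the dense domain to every vector.
-/
theorem tendsto_smul_resolvent {l : ℕ → ℝ} {R : ℕ → H →L[ℝ] H} (hκ : 0 ≤ κ)
    (hl : ∀ n, 2 * κ < l n) (hlim : Tendsto l atTop atTop) (hd : Dense (A.domain : Set H))
    (hR : ∀ n, IsResolvent A (l n) (R n)) (hb : ∀ n y, ‖R n y‖ ≤ (l n - κ)⁻¹ * ‖y‖) (y : H) :
    Tendsto (fun n => l n • R n y) atTop (𝓝 y) := by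
  have hp : ∀ n, 0 < l n - κ := fun n => by linarith [hl n]
  have hinv : Tendsto (fun n => (l n - κ)⁻¹) atTop (𝓝 0) :=
    (tendsto_atTop_add_const_right _ (-κ) hlim).inv_tendsto_atTop
  have h2 : ∀ n z, ‖l n • R n z‖ ≤ 2 * ‖z‖ := by
    intro n z
    have hn : 0 ≤ l n := by linarith [hl n]
    rw [norm_smul, Real.norm_of_nonneg hn]
    calc l n * ‖R n z‖ ≤ l n * ((l n - κ)⁻¹ * ‖z‖) := by gcongr; exact hb n z
      _ = (l n / (l n - κ)) * ‖z‖ := by ring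
      _ ≤ 2 * ‖z‖ := by
        gcongr
        rw [div_le_iff₀ (hp n)]; linarith [hl n]
  rw [Metric.tendsto_atTop]
  intro ε hε
  obtain ⟨y', hy', hyy⟩ := hd.exists_dist_lt y (ε := ε / 6) (by positivity)
  have hg := A.mem_graph ⟨y', hy'⟩
  set w := A ⟨y', hy'⟩
  have h3 : Tendsto (fun n => (l n - κ)⁻¹ * ‖w‖) atTop (𝓝 0) := by
    simpa using hinv.mul_const ‖w‖
  obtain ⟨N, hN⟩ := Metric.tendsto_atTop.1 h3 (ε / 2) (by positivity)
  refine ⟨N, fun n hn => ?_⟩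
  have h4 := hN n hn
  rw [Real.dist_eq, sub_zero] at h4
  have h5 : l n • R n y' - y' = R n w := by
    have := (hR n y' w).1 hg
    rw [map_sub, map_smul, sub_eq_iff_eq_add] at this
    rw [sub_eq_iff_eq_add, this]; abel
  have h6 : ‖l n • R n y' - y'‖ < ε / 2 := by
    rw [h5]; exact (hb n w).trans_lt ((le_abs_self _).trans_lt h4)
  have h7 := h2 n (y - y')
  rw [dist_eq_norm] at hyy ⊢
  have e : l n • R n y - y = l n • R n (y - y') + (l n • R n y' - y') - (y - y') := by
    rw [map_sub]; module
  rw [e]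
  refine (norm_sub_le _ _).trans_lt ?_
  have := norm_add_le (l n • R n (y - y')) (l n • R n y' - y')
  linarith

/-- Two solutions of `w' = A w` with the same initial value coincide. -/
theorem IsQuasiDissipative.eq_zero_of_hasDerivWithinAt (hA : IsQuasiDissipative A κ) {w w' : ℝ → H}
    (hw : ∀ t, 0 ≤ t → HasDerivWithinAt w (w' t) (Ici 0) t)
    (hg : ∀ t, 0 ≤ t → (w t, w' t) ∈ A.graph) (h0 : w 0 = 0) {t : ℝ} (ht : 0 ≤ t) : w t = 0 := by
  have := norm_le_exp_of_inner_deriv_le hw (fun s hs => hA.inner_le (hg s hs)) ht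
  rw [h0, norm_zero, mul_zero] at this
  exact norm_le_zero_iff.1 this

theorem tendsto_slope_zero_of_hasDerivWithinAt_Ici {f : ℝ → H} {y : H}
    (h : HasDerivWithinAt f y (Ici 0) 0) :
    Tendsto (fun t : ℝ => t⁻¹ • (f t - f 0)) (𝓝[>] 0) (𝓝 y) := by
  have := (hasDerivWithinAt_iff_tendsto_slope' (by simp)).1 (h.mono Ioi_subset_Ici_self)
  exact this.congr fun t => by simp [slope]

variable [CompleteSpace H]

open NormedSpace in
/-- The Lumer–Phillips construction: a densely defined quasi-dissipative operator whose resolvent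
exists near infinity gives rise to a `C₀`-semigroup. -/
theorem IsQuasiDissipative.exists_semigroup {lam₀ : ℝ} (hA : IsQuasiDissipative A κ)
    (hκ : 0 ≤ κ) (hr : ∀ l, lam₀ < l → ∀ y : H, ∃ x : A.domain, l • (x : H) - A x = y) :
    ∃ S : ℝ → H →L[ℝ] H, IsC0Semigroup S ∧ (∀ x, Continuous fun t => S t x) ∧
      (∀ t, 0 ≤ t → ∀ x y, (x, y) ∈ A.graph → (S t x, S t y) ∈ A.graph) ∧
      (∃ l, ∃ R : H →L[ℝ] H, IsResolvent A l R ∧ ∀ t, 0 ≤ t → ∀ x, R (S t x) = S t (R x)) ∧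
      ∀ t, 0 ≤ t → ∀ x y, (x, y) ∈ A.graph → S t x - x = ∫ s in (0 : ℝ)..t, S s y := by
  -- The shift puts every `l n` above `lam₀`, `κ` and `2 κ`; distinct indices give distinct values,
  -- as the commutation of resolvents requires.
  let l : ℕ → ℝ := fun n => n + (1 + 2 * κ + |lam₀|)
  have hl2 : ∀ n, 2 * κ < l n := fun n => by
    have := abs_nonneg lam₀
    have : (0 : ℝ) ≤ n := n.cast_nonneg
    simp only [l]; linarith
  have hl0 : ∀ n, lam₀ < l n := fun n => by
    have := le_abs_self lam₀
    have : (0 : ℝ) ≤ n := n.cast_nonneg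
    simp only [l]; linarith
  have hl1 : ∀ n, κ < l n := fun n => by linarith [hl2 n]
  have hlim : Tendsto l atTop atTop :=
    tendsto_atTop_add_const_right _ _ tendsto_natCast_atTop_atTop
  have hd : Dense (A.domain : Set H) := hA.dense_domain (hl1 0) (hr _ (hl0 0))
  choose R hR hb using fun n => hA.exists_resolvent (hl1 n) (hr _ (hl0 n))
  have hRR : ∀ i j, Commute (R i) (R j) := by
    intro i j
    rcases eq_or_ne i j with rfl | hij
    · exact Commute.refl _
    · refine (hR i).comm (hR j) fun h => hij ?_
      simpa [l] using h
  let B : ℕ → H →L[ℝ] H := fun n => yosida (l n) (R n)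
  have hB : ∀ n x, inner ℝ (B n x) x ≤ 2 * κ * ‖x‖ ^ 2 := fun n =>
    inner_yosida_le hκ (hl2 n) (hb n)
  have hBB : ∀ i j, Commute (B i) (B j) := fun i j => IsResolvent.commute_yosida (hRR i j)
  have hBlim : ∀ x y, (x, y) ∈ A.graph → Tendsto (fun n => B n x) atTop (𝓝 y) := by
    intro x y h
    simp only [B, (hR _).yosida_eq h]
    exact tendsto_smul_resolvent hκ hl2 hlim hd hR hb y
  obtain ⟨S, hS, hSc⟩ := exists_limit_exp (by positivity) hB hBB hd fun x hx =>
    (hBlim x _ (A.mem_graph ⟨x, hx⟩)).cauchySeq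
  have hE : ∀ t, 0 ≤ t → ∀ n x, ‖exp (t • B n) x‖ ≤ Real.exp (2 * κ * t) * ‖x‖ :=
    fun t ht n x => norm_exp_smul_apply_le (hB n) ht x
  -- The bound on the exponentials, uniform in `n`, lets their arguments move with `n`. This serves
  -- both the semigroup law and the passage to the limit under the integral.
  have hS' : ∀ t, 0 ≤ t → ∀ (x : ℕ → H) (y : H), Tendsto x atTop (𝓝 y) →
      Tendsto (fun n => exp (t • B n) (x n)) atTop (𝓝 (S t y)) := by
    intro t ht x y hx
    have h1 : Tendsto (fun n => exp (t • B n) (x n - y)) atTop (𝓝 0) := by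
      refine squeeze_zero_norm (fun n => hE t ht n _) ?_
      have := (tendsto_iff_norm_sub_tendsto_zero.1 hx).const_mul (Real.exp (2 * κ * t))
      simpa using this
    have := h1.add (hS t ht y)
    simpa [map_sub] using this
  have hcomm : ∀ t, 0 ≤ t → ∀ x, R 0 (S t x) = S t (R 0 x) := by
    intro t ht x
    refine tendsto_nhds_unique (((R 0).continuous.tendsto _).comp (hS t ht x)) ?_
    refine (hS t ht (R 0 x)).congr fun n => ?_
    have h1 : Commute (R 0) (B n) := by
      have : Commute (R 0) (ContinuousLinearMap.id ℝ H) := Commute.one_right _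
      exact ((hRR 0 n).smul_right _).sub_right (this.smul_right _)
    exact (congrArg (fun T : H →L[ℝ] H => T x) (h1.smul_right t).exp_right.eq).symm
  refine ⟨S, ⟨?_, ?_, ?_⟩, hSc, ?_, ⟨l 0, R 0, hR 0, hcomm⟩, ?_⟩
  · ext x
    refine tendsto_nhds_unique (hS 0 le_rfl x) ?_
    simp
  · intro s t hs ht
    ext x
    refine tendsto_nhds_unique (hS (s + t) (add_nonneg hs ht) x) ?_
    refine (hS' s hs _ _ (hS t ht x)).congr fun n => ?_
    have h1 : Commute (s • B n) (t • B n) := ((Commute.refl _).smul_left _).smul_right _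
    let _ : NormedAlgebra ℚ (H →L[ℝ] H) := NormedAlgebra.restrictScalars ℚ ℝ _
    rw [add_smul, exp_add_of_commute h1]
    rfl
  · intro x
    have h0 : S 0 x = x := tendsto_nhds_unique (hS 0 le_rfl x) (by simp)
    have := (hSc x).tendsto 0
    rw [h0] at this
    exact this.mono_left nhdsWithin_le_nhds
  · intro t ht x y h
    rw [hR 0, ← map_smul, ← map_sub, hcomm t ht, (hR 0 x y).1 h]
  · intro t ht x y h
    have hcont : ∀ n z, Continuous fun s : ℝ => exp (s • B n) z := fun n z =>
      continuous_iff_continuousAt.2 fun s => (hasDerivAt_exp_smul_apply (B n) z s).continuousAt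
    have h1 : ∀ n, exp (t • B n) x - x = ∫ s in (0 : ℝ)..t, exp (s • B n) (B n x) := by
      intro n
      have hder : ∀ s ∈ uIcc 0 t, HasDerivAt (fun s : ℝ => exp (s • B n) x)
          (exp (s • B n) (B n x)) s := by
        intro s _
        refine (hasDerivAt_exp_smul_apply (B n) x s).congr_deriv ?_
        exact congrArg (fun T : H →L[ℝ] H => T x) ((Commute.refl (B n)).smul_right s).exp_right.eq
      rw [intervalIntegral.integral_eq_sub_of_hasDerivAt hder
        ((hcont n _).intervalIntegrable _ _)]
      simp
    -- Convergence of `B n x` bounds these vectors uniformly, which supplies the constant dominating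
    -- function on `[0, t]`.
    obtain ⟨C, hC⟩ := (hBlim x y h).norm.bddAbove_range
    have hC' : ∀ n, ‖B n x‖ ≤ C := fun n => hC ⟨n, rfl⟩
    refine tendsto_nhds_unique ((hS t ht x).sub_const x) ?_
    simp only [h1]
    refine intervalIntegral.tendsto_integral_filter_of_dominated_convergence
      (fun _ => Real.exp (2 * κ * t) * C) (Eventually.of_forall fun n =>
        (hcont n _).aestronglyMeasurable) (Eventually.of_forall fun n => ?_)
      intervalIntegrable_const ?_
    · refine ae_of_all _ fun s hs => ?_
      rw [uIoc_of_le ht] at hs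
      refine (hE s hs.1.le n _).trans ?_
      gcongr
      · exact hs.2
      · exact hC' n
    · refine ae_of_all _ fun s hs => ?_
      rw [uIoc_of_le ht] at hs
      exact hS' s hs.1.le _ _ (hBlim x y h)

theorem hasDerivWithinAt_integral_Ici {Φ : ℝ → H} (hΦ : ContinuousOn Φ (Ici 0)) {t : ℝ}
    (ht : 0 ≤ t) : HasDerivWithinAt (fun t => ∫ s in (0 : ℝ)..t, Φ s) (Φ t) (Ici 0) t := by
  -- Continuity is known only on `[0, ∞)`; this extension is continuous on `ℝ` and has the same
  -- integrals from `0` to `t ≥ 0`, so the two-sided fundamental theorem applies.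
  let Ψ : ℝ → H := fun t => Φ (max t 0)
  have hΨ : Continuous Ψ := hΦ.comp_continuous (by fun_prop) fun t => mem_Ici.2 (le_max_right _ _)
  have h1 : HasDerivAt (fun t => ∫ s in (0 : ℝ)..t, Ψ s) (Ψ t) t :=
    intervalIntegral.integral_hasDerivAt_right (hΨ.intervalIntegrable _ _)
      (hΨ.stronglyMeasurableAtFilter _ _) hΨ.continuousAt
  have h2 : ∀ t, 0 ≤ t → ∫ s in (0 : ℝ)..t, Φ s = ∫ s in (0 : ℝ)..t, Ψ s := by
    intro t ht
    refine intervalIntegral.integral_congr fun s hs => ?_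
    rw [uIcc_of_le ht] at hs
    simp only [Ψ, max_eq_left hs.1]
  have h3 : Ψ t = Φ t := by simp only [Ψ, max_eq_left ht]
  rw [← h3]
  exact h1.hasDerivWithinAt.congr (fun s hs => h2 s hs) (h2 t ht)

/-- The Lumer–Phillips theorem, with the resulting well-posedness of the Cauchy problem. -/
theorem IsQuasiDissipative.isWellPosed {lam₀ : ℝ} (hA₀ : IsQuasiDissipative A κ)
    (hr : ∀ l, lam₀ < l → ∀ y : H, ∃ x : A.domain, l • (x : H) - A x = y) : IsWellPosed A := by
  -- The Yosida estimate needs a nonnegative constant, and enlarging `κ` is free.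
  have hA : IsQuasiDissipative A (max κ 0) := fun x => (hA₀ x).trans (by gcongr; exact le_max_left _ _)
  obtain ⟨S, hS, hSc, hSA, ⟨l, R, hR, hRS⟩, hSint⟩ := hA.exists_semigroup (le_max_right _ _) hr
  have hS0 : ∀ x, S 0 x = x := fun x => by rw [hS.map_zero]; rfl
  have hder : ∀ x y, (x, y) ∈ A.graph → ∀ t, 0 ≤ t →
      HasDerivWithinAt (fun t => S t x) (S t y) (Ici 0) t := by
    intro x y h t ht
    have h1 := (hasDerivWithinAt_integral_Ici (hSc y).continuousOn ht).const_add x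
    have h2 : ∀ s, 0 ≤ s → S s x = x + ∫ r in (0 : ℝ)..s, S r y := fun s hs => by
      rw [← hSint s hs x y h]; abel
    exact h1.congr (fun s hs => h2 s hs) (h2 t ht)
  -- For `x` outside the domain, `S t` cannot be differentiated at `x`. Membership in the graph is
  -- therefore tested through the resolvent: `R` commutes with `S` and with the integral, and `R x`
  -- lies in the domain, where the integral formula is available.
  have hmild : ∀ x t, 0 ≤ t → (∫ s in (0 : ℝ)..t, S s x, S t x - x) ∈ A.graph := by
    intro x t ht
    have hint : ∀ z, IntervalIntegrable (fun s => S s z) volume 0 t :=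
      fun z => (hSc z).intervalIntegrable _ _
    have e1 : R (∫ s in (0 : ℝ)..t, S s x) = ∫ s in (0 : ℝ)..t, S s (R x) := by
      rw [← R.intervalIntegral_comp_comm (hint x)]
      refine intervalIntegral.integral_congr fun s hs => ?_
      rw [uIcc_of_le ht] at hs
      exact hRS s hs.1 x
    have e2 := hSint t ht _ _ (hR.mem_graph x)
    simp only [map_sub, map_smul] at e2
    have hi := (hint (R x)).smul l
    simp only [Pi.smul_def] at hi
    rw [intervalIntegral.integral_sub hi (hint x),
      intervalIntegral.integral_smul] at e2
    rw [hR, map_sub, map_smul, e1, map_sub, hRS t ht, e2]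
    abel
  refine ⟨hA.dense_domain (lam := max (max κ 0) lam₀ + 1) ?_ (hr _ ?_), S, hS, ?_, ?_, ?_⟩
  · exact (le_max_left _ _).trans_lt (lt_add_one _)
  · exact (le_max_right _ _).trans_lt (lt_add_one _)
  · intro x y
    constructor
    · intro h
      have := tendsto_slope_zero_of_hasDerivWithinAt_Ici (hder x y h 0 le_rfl)
      simpa only [hS0] using this
    · intro h
      -- The averages of the orbit lie in the domain, `A` maps them to the difference quotients, and
      -- they converge to `x`. Closedness of the graph then puts `(x, y)` in it.
      have h1 : Tendsto (fun t : ℝ => t⁻¹ • ∫ s in (0 : ℝ)..t, S s x) (𝓝[>] 0) (𝓝 x) := by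
        have := tendsto_slope_zero_of_hasDerivWithinAt_Ici
          (hasDerivWithinAt_integral_Ici (hSc x).continuousOn le_rfl)
        simpa only [hS0, intervalIntegral.integral_same, sub_zero] using this
      have h2 : Tendsto (fun t : ℝ => (t⁻¹ • ∫ s in (0 : ℝ)..t, S s x, t⁻¹ • (S t x - x)))
        (𝓝[>] 0) (𝓝 (x, y)) := h1.prodMk_nhds h
      refine hR.isClosed_graph.mem_of_tendsto h2 ?_
      filter_upwards [self_mem_nhdsWithin] with t ht
      exact A.graph.smul_mem t⁻¹ (hmild x t (le_of_lt ht))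
  · intro x hx
    have hg := A.mem_graph ⟨x, hx⟩
    set y := A ⟨x, hx⟩
    have hgt := fun t (ht : 0 ≤ t) => hSA t ht x y hg
    have hmem : ∀ t, 0 ≤ t → S t x ∈ A.domain := fun t ht =>
      A.mem_domain_of_mem_graph (hgt t ht)
    refine ⟨⟨hS0 x, hmem, ?_, ?_, ?_⟩, ?_⟩
    · rw [contDiffOn_one_iff_derivWithin (uniqueDiffOn_Ici 0)]
      refine ⟨fun t ht => (hder x y hg t ht).differentiableWithinAt, ?_⟩
      exact (hSc y).continuousOn.congr fun t ht =>
        (hder x y hg t ht).derivWithin (uniqueDiffOn_Ici 0 t ht)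
    · have : (fun t : Ici (0 : ℝ) => A ⟨S t x, hmem t t.2⟩) = fun t : Ici (0 : ℝ) => S t y :=
        funext fun t => apply_eq_of_mem_graph (hgt t t.2) _
      rw [this]
      exact (hSc y).comp continuous_subtype_val
    · intro t ht
      rw [apply_eq_of_mem_graph (hgt t ht)]
      exact hder x y hg t ht
    · intro Ψ hΨ t ht
      refine sub_eq_zero.1 (hA.eq_zero_of_hasDerivWithinAt (w := fun t => Ψ t - S t x)
        (w' := fun t => if h : 0 ≤ t then A ⟨Ψ t, hΨ.mem_domain t h⟩ - S t y else 0) ?_ ?_ ?_ ht)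
      · intro s hs
        rw [dif_pos hs]
        exact (hΨ.hasDerivWithinAt s hs).sub (hder x y hg s hs)
      · intro s hs
        simp only [dif_pos hs]
        exact A.graph.sub_mem (A.mem_graph ⟨Ψ s, _⟩) (hgt s hs)
      · simp only [hΨ.initial, hS0, sub_self]
  · intro x
    refine ⟨⟨(hSc x).continuousOn, hmild x⟩, ?_⟩
    intro Ψ hΨ t ht
    -- The difference of the time integrals of two mild solutions is a differentiable solution with
    -- zero initial value, since the initial data cancel. It vanishes by the energy estimate, and so
    -- does its derivative, which is the difference of the solutions.
    have hd : ∀ s, 0 ≤ s → HasDerivWithinAt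
        (fun t => (∫ s in (0 : ℝ)..t, Ψ s) - ∫ s in (0 : ℝ)..t, S s x) (Ψ s - S s x) (Ici 0) s :=
      fun s hs => (hasDerivWithinAt_integral_Ici hΨ.continuousOn hs).sub
        (hasDerivWithinAt_integral_Ici (hSc x).continuousOn hs)
    have hz : ∀ s, 0 ≤ s →
        ((∫ s in (0 : ℝ)..s, Ψ s) - ∫ s in (0 : ℝ)..s, S s x) = 0 := fun s hs => by
      refine hA.eq_zero_of_hasDerivWithinAt hd (fun s hs => ?_) (by simp) hs
      have := A.graph.sub_mem (hΨ.integral_mem_graph s hs) (hmild x s hs)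
      rw [Prod.mk_sub_mk] at this
      convert this using 2
      abel
    have hc : HasDerivWithinAt
        (fun t => (∫ s in (0 : ℝ)..t, Ψ s) - ∫ s in (0 : ℝ)..t, S s x) 0 (Ici 0) t :=
      (hasDerivWithinAt_const t _ (0 : H)).congr (fun s hs => hz s hs) (hz t ht)
    exact sub_eq_zero.1 ((uniqueDiffOn_Ici 0 t ht).eq_deriv _ (hd t ht) hc)

end Generation

/-! ### Calculus in `H¹(0, 1)`: traces, completeness, products and inverses -/

section Sobolev

theorem L2.inner_eq (f g : L2) : inner ℝ f g = ∫ x in Ioo (0 : ℝ) 1, f x * g x := by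
  rw [L2.inner_def]
  exact integral_congr_ae (ae_of_all _ fun x => by simp [mul_comm])

instance isProbabilityMeasure_unitMeasure : IsProbabilityMeasure unitMeasure :=
  ⟨by simp⟩

/-- The interval has measure one, so the `L¹` norm is at most the `L²` norm. -/
theorem L2.integral_abs_le (f : L2) : ∫ x in Ioo (0 : ℝ) 1, |f x| ≤ ‖f‖ := by
  have h1 : eLpNorm f 1 unitMeasure ≤ eLpNorm f 2 unitMeasure :=
    eLpNorm_le_eLpNorm_of_exponent_le (by norm_num) (Lp.aestronglyMeasurable f)
  have h2 : ∫ x in Ioo (0 : ℝ) 1, |f x| = (eLpNorm f 1 unitMeasure).toReal := by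
    rw [eLpNorm_one_eq_lintegral_enorm, ← integral_norm_eq_lintegral_enorm
      (Lp.aestronglyMeasurable f)]
    rfl
  rw [h2, Lp.norm_def]
  exact ENNReal.toReal_mono (Lp.eLpNorm_ne_top f) h1

theorem L2.abs_integral_le (f : L2) : |∫ x in Ioo (0 : ℝ) 1, f x| ≤ ‖f‖ :=
  abs_integral_le_integral_abs.trans f.integral_abs_le

/-- Together with `H1.exists_ac_rep` this identifies `H¹` with the absolutely continuous functions
whose derivative is in `L²`. Products, inverses and integration by parts can then be handled
pointwise. -/
theorem H1.exists_of_ac {F : ℝ → ℝ} (hF : AbsolutelyContinuousOnInterval F 0 1) {g : L2}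
    (hg : g =ᵐ[unitMeasure] deriv F) : ∃ f : H1, EqOn f.rep F (Icc 0 1) ∧ f.der = g := by
  have hc := hF.continuousOn
  rw [uIcc_of_le zero_le_one] at hc
  obtain ⟨C, hC⟩ := isCompact_Icc.exists_bound_of_continuousOn hc
  have hm : MemLp F 2 unitMeasure := MemLp.of_bound
    ((hc.mono Ioo_subset_Icc_self).aestronglyMeasurable measurableSet_Ioo) C (ae_unit_of_Icc hC)
  refine ⟨⟨WithLp.toLp 2 (hm.toLp _, g), isWeakDeriv_of_ac hF hm.coeFn_toLp hg⟩, ?_, rfl⟩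
  exact H1.rep_eqOn hc hm.coeFn_toLp

theorem H1.exists_ac_rep (f : H1) : ∃ F : ℝ → ℝ, AbsolutelyContinuousOnInterval F 0 1 ∧
    EqOn f.rep F (Icc 0 1) ∧ f.der =ᵐ[unitMeasure] deriv F := by
  obtain ⟨F, hF, h1, h2⟩ := f.exists_ac
  have hc := hF.continuousOn
  rw [uIcc_of_le zero_le_one] at hc
  exact ⟨F, hF, H1.rep_eqOn hc h1, h2⟩

theorem H1.ext_rep {f g : H1} (h : EqOn f.rep g.rep (Icc 0 1)) : f = g := by
  apply H1.toL2_injective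
  apply Lp.ext
  filter_upwards [f.toL2_ae_eq_rep, g.toL2_ae_eq_rep, ae_unit_of_Icc h] with x h1 h2 h3
  rw [h1, h2, h3]

theorem H1.exists_primitive (g : L2) (c : ℝ) : ∃ f : H1, f.der = g ∧ f.at0 = c := by
  let G : ℝ → ℝ := fun x => ∫ t in (0 : ℝ)..x, g t
  have hG : AbsolutelyContinuousOnInterval G 0 1 :=
    g.intervalIntegrable.absolutelyContinuousOnInterval_intervalIntegral (by simp)
  have hG' : ∀ᵐ x ∂unitMeasure, HasDerivAt G (g x) x := by
    apply ae_unit_of_ae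
    filter_upwards [g.intervalIntegrable.ae_hasDerivAt_integral] with x hx hx'
    exact hx hx' 0 (by simp)
  have hcac : AbsolutelyContinuousOnInterval (fun _ : ℝ => c) 0 1 :=
    contDiffOn_const.absolutelyContinuousOnInterval
  obtain ⟨f, hf, hf'⟩ := H1.exists_of_ac (hG.add hcac) (g := g) (by
    filter_upwards [hG'] with x hx
    exact ((hx.add_const c).deriv).symm)
  refine ⟨f, hf', ?_⟩
  change f.rep 0 = c
  rw [hf (by simp)]
  simp [G]

/-- Integration by parts in `H¹(0, 1)`. -/
theorem H1.inner_der_add (f g : H1) :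
    inner ℝ f.der g.toL2 + inner ℝ f.toL2 g.der = f.at1 * g.at1 - f.at0 * g.at0 := by
  obtain ⟨F, hF, hF1, hF2⟩ := f.exists_ac_rep
  obtain ⟨G, hG, hG1, hG2⟩ := g.exists_ac_rep
  have h := hF.integral_deriv_mul_eq_sub hG
  rw [← setIntegral_eq_interval] at h
  rw [L2.inner_eq, L2.inner_eq, ← integral_add (f.der.integrable_mul _) (f.toL2.integrable_mul _)]
  change _ = f.rep 1 * g.rep 1 - f.rep 0 * g.rep 0
  rw [hF1 (by simp), hG1 (by simp), hF1 (by simp), hG1 (by simp), ← h]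
  apply integral_congr_ae
  filter_upwards [hF2, hG2, f.toL2_ae_eq_rep, g.toL2_ae_eq_rep, ae_unit_of_Icc hF1,
    ae_unit_of_Icc hG1] with x h1 h2 h3 h4 h5 h6
  rw [h1, h2, h3, h4, h5, h6]

theorem H1.abs_rep_sub_le (f : H1) {x : ℝ} (hx : x ∈ Icc (0 : ℝ) 1) :
    |f.rep x - f.at0| ≤ ‖f.der‖ := by
  obtain ⟨F, hF, hF1, hF2⟩ := f.exists_ac_rep
  have hFx : AbsolutelyContinuousOnInterval F 0 x := hF.mono (by
    rw [uIcc_of_le hx.1, uIcc_of_le zero_le_one]; exact Icc_subset_Icc_right hx.2)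
  change |f.rep x - f.rep 0| ≤ _
  rw [hF1 hx, hF1 (by simp), ← hFx.integral_deriv_eq_sub, intervalIntegral.integral_of_le hx.1,
    integral_Ioc_eq_integral_Ioo]
  refine le_trans ?_ f.der.integral_abs_le
  have e : ∫ t in Ioo (0 : ℝ) x, deriv F t = ∫ t in Ioo (0 : ℝ) x, f.der t :=
    (integral_congr_ae (ae_restrict_of_ae_restrict_of_subset
      (Ioo_subset_Ioo_right hx.2) hF2)).symm
  rw [e]
  refine abs_integral_le_integral_abs.trans ?_
  exact setIntegral_mono_set f.der.integrable.abs (ae_of_all _ fun t => abs_nonneg _)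
    (Ioo_subset_Ioo_right hx.2).eventuallyLE

/-- Averaging `|f(0)| ≤ |f(x)| + ‖f'‖` over `x` gives the bound, and with it the continuity of the
trace. -/
theorem H1.abs_at0_le (f : H1) : |f.at0| ≤ ‖f.toL2‖ + ‖f.der‖ := by
  have h1 : ∀ᵐ x ∂unitMeasure, |f.at0| ≤ |f.toL2 x| + ‖f.der‖ := by
    filter_upwards [f.toL2_ae_eq_rep, ae_unit_of_Icc fun x hx => f.abs_rep_sub_le hx] with x h1 h2
    rw [h1]
    have := abs_sub_abs_le_abs_sub f.at0 (f.rep x)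
    rw [abs_sub_comm] at this
    linarith
  have h2 := integral_mono_ae (integrable_const _)
    (f.toL2.integrable.abs.add (integrable_const ‖f.der‖)) h1
  simp only [Pi.add_apply] at h2
  rw [integral_add f.toL2.integrable.abs (integrable_const _)] at h2
  simp only [integral_const, probReal_univ, one_smul] at h2
  linarith [f.toL2.integral_abs_le]

theorem H1.abs_at1_le (f : H1) : |f.at1| ≤ |f.at0| + ‖f.der‖ := by
  have h1 := f.abs_rep_sub_le (x := 1) (by simp)
  have h2 := abs_sub_abs_le_abs_sub (f.rep 1) f.at0
  change |f.rep 1| ≤ _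
  linarith

theorem H1.norm_sq_eq (f : H1) : ‖f‖ ^ 2 = ‖f.toL2‖ ^ 2 + ‖f.der‖ ^ 2 :=
  WithLp.prod_norm_sq_eq_of_L2 f.1

theorem H1.norm_toL2_le (f : H1) : ‖f.toL2‖ ≤ ‖f‖ := by
  refine abs_le_of_sq_le_sq' ?_ (norm_nonneg _) |>.2
  rw [f.norm_sq_eq]; linarith [sq_nonneg ‖f.der‖]

theorem H1.norm_der_le (f : H1) : ‖f.der‖ ≤ ‖f‖ := by
  refine abs_le_of_sq_le_sq' ?_ (norm_nonneg _) |>.2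
  rw [f.norm_sq_eq]; linarith [sq_nonneg ‖f.toL2‖]

/-- The inclusion `H¹(0, 1) → L²(0, 1)` as a bounded operator. -/
def H1.toL2L : H1 →L[ℝ] L2 := H1.toL2.mkContinuous 1 fun f => by
  rw [one_mul]; exact f.norm_toL2_le

/-- The weak derivative as a bounded operator. -/
def H1.derL : H1 →L[ℝ] L2 := H1.der.mkContinuous 1 fun f => by
  rw [one_mul]; exact f.norm_der_le

/-- The trace at `0` as a bounded functional. -/
def H1.at0L : H1 →L[ℝ] ℝ := H1.at0.mkContinuous 2 fun f => by
  rw [Real.norm_eq_abs]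
  linarith [f.abs_at0_le, f.norm_toL2_le, f.norm_der_le]

/-- The trace at `1` as a bounded functional. -/
def H1.at1L : H1 →L[ℝ] ℝ := H1.at1.mkContinuous 3 fun f => by
  rw [Real.norm_eq_abs]
  linarith [f.abs_at0_le, f.abs_at1_le, f.norm_toL2_le, f.norm_der_le]

theorem continuous_integral_mul_test {φ : ℝ → ℝ} (hφ : Continuous φ) (hc : HasCompactSupport φ) :
    Continuous fun f : L2 => ∫ x in Ioo (0 : ℝ) 1, f x * φ x := by
  obtain ⟨C, hC⟩ := hc.exists_bound_of_continuous hφ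
  have hm : MemLp φ 2 unitMeasure :=
    MemLp.of_bound hφ.aestronglyMeasurable C (ae_of_all _ hC)
  have : (fun f : L2 => ∫ x in Ioo (0 : ℝ) 1, f x * φ x) = fun f : L2 => inner ℝ f (hm.toLp φ) := by
    ext1 f
    rw [L2.inner_eq]
    exact (integral_congr_ae (hm.coeFn_toLp.mono fun x hx => by simp only [hx])).symm
  rw [this]
  fun_prop

/-- Each test function imposes one closed linear condition on the pair. Completeness of `H¹`
follows, as needed for Lax–Milgram and for completeness of the energy space. -/
theorem isClosed_sobolevH1 : IsClosed (sobolevH1 : Set (WithLp 2 (L2 × L2))) := by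
  have : (sobolevH1 : Set (WithLp 2 (L2 × L2))) = ⋂ (φ : ℝ → ℝ) (_ : ContDiff ℝ ∞ φ)
      (_ : HasCompactSupport φ) (_ : tsupport φ ⊆ Ioo (0 : ℝ) 1),
      {p | ∫ x in Ioo (0 : ℝ) 1, p.fst x * deriv φ x = - ∫ x in Ioo (0 : ℝ) 1, p.snd x * φ x} := by
    ext p
    simp only [mem_iInter]
    rfl
  rw [this]
  refine isClosed_iInter fun φ => isClosed_iInter fun h1 => isClosed_iInter fun h2 =>
    isClosed_iInter fun _ => isClosed_eq ?_ ?_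
  · exact (continuous_integral_mul_test (h1.continuous_deriv (by norm_num)) h2.deriv).comp
      (WithLp.fstL 2 ℝ L2 L2).continuous
  · exact ((continuous_integral_mul_test h1.continuous h2).comp
      (WithLp.sndL 2 ℝ L2 L2).continuous).neg

instance H1.completeSpace : CompleteSpace H1 := isClosed_sobolevH1.completeSpace_coe

/-- Multiplication by the coefficient `a ∈ H¹(0, 1)` on `L²(0, 1)`. -/
def mulL2 (a : H1) : L2 →L[ℝ] L2 :=
  LinearMap.mkContinuousOfExistsBound
    { toFun := fun g => (memLp_mul_L2 a.continuousOn_rep g).toLp _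
      map_add' := fun f g => by
        apply Lp.ext
        filter_upwards [(memLp_mul_L2 a.continuousOn_rep (f + g)).coeFn_toLp,
          (memLp_mul_L2 a.continuousOn_rep f).coeFn_toLp,
          (memLp_mul_L2 a.continuousOn_rep g).coeFn_toLp, L2.ae_add f g,
          L2.ae_add ((memLp_mul_L2 a.continuousOn_rep f).toLp _)
            ((memLp_mul_L2 a.continuousOn_rep g).toLp _)] with x h1 h2 h3 h4 h5
        rw [h1, h5, h2, h3, h4]; ring
      map_smul' := fun c g => by
        apply Lp.ext
        filter_upwards [(memLp_mul_L2 a.continuousOn_rep (c • g)).coeFn_toLp,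
          (memLp_mul_L2 a.continuousOn_rep g).coeFn_toLp, L2.ae_smul c g,
          L2.ae_smul c ((memLp_mul_L2 a.continuousOn_rep g).toLp _)] with x h1 h2 h3 h4
        rw [RingHom.id_apply, h1, h4, h2, h3]; ring }
    (by
      obtain ⟨C, hC⟩ := isCompact_Icc.exists_bound_of_continuousOn a.continuousOn_rep
      refine ⟨C, fun g => ?_⟩
      refine Lp.norm_le_mul_norm_of_ae_le_mul ?_
      filter_upwards [(memLp_mul_L2 a.continuousOn_rep g).coeFn_toLp, ae_unit_of_Icc hC] with x h1 h2
      change ‖((memLp_mul_L2 a.continuousOn_rep g).toLp _ : L2) x‖ ≤ _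
      rw [h1, norm_mul]
      gcongr)

theorem mulL2_ae (a : H1) (g : L2) : mulL2 a g =ᵐ[unitMeasure] fun x => a.rep x * g x :=
  (memLp_mul_L2 a.continuousOn_rep g).coeFn_toLp

theorem inner_mulL2 (a : H1) (f g : L2) :
    inner ℝ (mulL2 a f) g = ∫ x in Ioo (0 : ℝ) 1, a.rep x * f x * g x := by
  rw [L2.inner_eq]
  exact integral_congr_ae ((mulL2_ae a f).mono fun x hx => by simp only [hx])

theorem inner_mulL2_comm (a : H1) (f g : L2) :
    inner ℝ (mulL2 a f) g = inner ℝ (mulL2 a g) f := by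
  rw [inner_mulL2, inner_mulL2]
  congr 1; ext x; ring

theorem le_inner_mulL2 {a : H1} {a₀ : ℝ} (ha : ∀ x ∈ Icc (0 : ℝ) 1, a₀ ≤ a.rep x) (f : L2) :
    a₀ * ‖f‖ ^ 2 ≤ inner ℝ (mulL2 a f) f := by
  rw [inner_mulL2, ← real_inner_self_eq_norm_sq, L2.inner_eq, ← integral_const_mul]
  have hi : Integrable (fun x => a.rep x * f x * f x) unitMeasure :=
    (memLp_mul_L2 a.continuousOn_rep f).integrable_mul (Lp.memLp f)
  refine integral_mono_ae ((f.integrable_mul f).const_mul _) hi ?_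
  filter_upwards [ae_unit_of_Icc ha] with x hx
  have := mul_le_mul_of_nonneg_right hx (mul_self_nonneg (f x))
  linarith

theorem H1.rep_mulLeft (a f : H1) :
    EqOn (H1.mulLeft a f).rep (fun x => a.rep x * f.rep x) (Icc 0 1) :=
  H1.rep_eqOn (a.continuousOn_rep.mul f.continuousOn_rep) (H1.toL2_mulLeft a f)

theorem H1.at0_mulLeft (a f : H1) : (H1.mulLeft a f).at0 = a.at0 * f.at0 :=
  H1.rep_mulLeft a f (by simp)

theorem H1.toL2_mulLeft_eq (a f : H1) : (H1.mulLeft a f).toL2 = mulL2 a f.toL2 := by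
  apply Lp.ext
  filter_upwards [H1.toL2_mulLeft a f, mulL2_ae a f.toL2, f.toL2_ae_eq_rep] with x h1 h2 h3
  rw [h1, h2, h3]

/-- The product rule in `H¹(0, 1)`. -/
theorem H1.der_mulLeft (a f : H1) :
    (H1.mulLeft a f).der = mulL2 a f.der + mulL2 f a.der := by
  obtain ⟨F, hF, hF1, hF2⟩ := a.exists_ac_rep
  obtain ⟨G, hG, hG1, hG2⟩ := f.exists_ac_rep
  obtain ⟨p, hp, hp'⟩ := H1.exists_of_ac (hF.fun_mul hG) (g := mulL2 a f.der + mulL2 f a.der) (by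
    filter_upwards [L2.ae_add (mulL2 a f.der) (mulL2 f a.der), mulL2_ae a f.der, mulL2_ae f a.der,
      hF2, hG2, ae_unit_of_ae hF.ae_differentiableAt, ae_unit_of_ae hG.ae_differentiableAt,
      ae_unit_of_Icc hF1, ae_unit_of_Icc hG1] with x h1 h2 h3 h4 h5 h6 h7 h8 h9
    rw [h1, h2, h3, deriv_fun_mul h6 h7, h4, h5, h8, h9]; ring)
  rw [← hp']
  congr 1
  refine H1.ext_rep fun x hx => ?_
  rw [H1.rep_mulLeft a f hx, hp hx]
  simp only [hF1 hx, hG1 hx]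

/-- Inversion is Lipschitz with constant `1 / c²` on `[c, ∞)`, so the modulus of `F` for `ε c²`
works for its inverse. -/
theorem _root_.AbsolutelyContinuousOnInterval.inv_of_le {F : ℝ → ℝ} {a b c : ℝ}
    (hF : AbsolutelyContinuousOnInterval F a b) (hc : 0 < c) (h : ∀ x ∈ uIcc a b, c ≤ F x) :
    AbsolutelyContinuousOnInterval (fun x => (F x)⁻¹) a b := by
  rw [absolutelyContinuousOnInterval_iff] at hF ⊢
  intro ε hε
  obtain ⟨δ, hδ, hd⟩ := hF (ε * c ^ 2) (by positivity)
  refine ⟨δ, hδ, fun E h1 h2 => ?_⟩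
  have h3 := hd E h1 h2
  have h4 : ∀ i ∈ Finset.range E.1, dist (F (E.2 i).1)⁻¹ (F (E.2 i).2)⁻¹
      ≤ (c ^ 2)⁻¹ * dist (F (E.2 i).1) (F (E.2 i).2) := by
    intro i hi
    have h5 := h _ (h1.1 i hi).1
    have h6 := h _ (h1.1 i hi).2
    have p5 := hc.trans_le h5
    have p6 := hc.trans_le h6
    rw [Real.dist_eq, Real.dist_eq, inv_sub_inv p5.ne' p6.ne', abs_div, abs_sub_comm,
      abs_of_pos (mul_pos p5 p6), div_eq_inv_mul]
    gcongr
    nlinarith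
  refine (Finset.sum_le_sum h4).trans_lt ?_
  rw [← Finset.mul_sum, inv_mul_lt_iff₀ (by positivity)]
  linarith

/-- A coefficient in `H¹(0, 1)` that is bounded below by a positive constant is invertible. -/
theorem H1.exists_inv {a : H1} {a₀ : ℝ} (ha₀ : 0 < a₀) (ha : ∀ x ∈ Icc (0 : ℝ) 1, a₀ ≤ a.rep x) :
    ∃ b : H1, ∀ x ∈ Icc (0 : ℝ) 1, b.rep x = (a.rep x)⁻¹ := by
  obtain ⟨F, hF, hF1, hF2⟩ := a.exists_ac_rep
  have hF0 : ∀ x ∈ Icc (0 : ℝ) 1, a₀ ≤ F x := fun x hx => by rw [← hF1 hx]; exact ha x hx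
  have hG := hF.inv_of_le ha₀ (by rwa [uIcc_of_le zero_le_one])
  have hc := hF.continuousOn
  rw [uIcc_of_le zero_le_one] at hc
  have hc' : ContinuousOn (fun x => -(F x ^ 2)⁻¹) (Icc 0 1) :=
    ((hc.pow 2).inv₀ fun x hx => (pow_pos (ha₀.trans_le (hF0 x hx)) 2).ne').neg
  have hm := memLp_mul_L2 hc' a.der
  obtain ⟨b, hb, -⟩ := H1.exists_of_ac hG (g := hm.toLp _) (by
    filter_upwards [hm.coeFn_toLp, hF2, ae_unit_of_ae hF.ae_differentiableAt,
      ae_unit_of_Icc hF0] with x h1 h2 h3 h4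
    rw [h1, h2, deriv_fun_inv'' h3 (ha₀.trans_le h4).ne']
    field_simp)
  exact ⟨b, fun x hx => by rw [hb hx, hF1 hx]⟩

/-- Regularity for the elliptic problem: a flux `a g` in `H¹` forces `g` into `H¹`, because the
inverse of `a` is again in `H¹`. This turns a weak solution into one with `y ∈ H²`. -/
theorem H1.exists_mulL2_eq {a : H1} {a₀ : ℝ} (ha₀ : 0 < a₀)
    (ha : ∀ x ∈ Icc (0 : ℝ) 1, a₀ ≤ a.rep x) {g : L2} {w : H1} (h : w.toL2 = mulL2 a g) :
    ∃ f : H1, f.toL2 = g ∧ H1.mulLeft a f = w := by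
  obtain ⟨b, hb⟩ := H1.exists_inv ha₀ ha
  refine ⟨H1.mulLeft b w, ?_, ?_⟩
  · apply Lp.ext
    rw [H1.toL2_mulLeft_eq, h]
    filter_upwards [mulL2_ae b (mulL2 a g), mulL2_ae a g, ae_unit_of_Icc hb, ae_unit_of_Icc ha]
      with x h1 h2 h3 h4
    rw [h1, h2, h3, inv_mul_cancel_left₀ (ha₀.trans_le h4).ne']
  · refine H1.ext_rep fun x hx => ?_
    rw [H1.rep_mulLeft a _ hx]
    simp only [H1.rep_mulLeft b w hx, hb x hx]
    rw [mul_inv_cancel_left₀ (ha₀.trans_le (ha x hx)).ne']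

end Sobolev

/-! ### Equivalence of the energy norm and the product norm -/

section EnergyNorm

theorem WithInner.inner_of {V : Type*} [AddCommGroup V] [Module ℝ V]
    (c : InnerProductSpace.Core ℝ V) (v w : V) :
    inner ℝ (WithInner.of c v) (WithInner.of c w) = c.inner v w := rfl

theorem WithInner.norm_of_sq {V : Type*} [AddCommGroup V] [Module ℝ V]
    (c : InnerProductSpace.Core ℝ V) (v : V) : ‖WithInner.of c v‖ ^ 2 = c.inner v v := by
  rw [← WithInner.inner_of, real_inner_self_eq_norm_sq]

theorem energyInner_eq (a : H1) (σ α τ m M K ϖ : ℝ) (Φ Ψ : StateSpace) :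
    energyInner a σ α τ m M K ϖ Φ Ψ = inner ℝ (mulL2 a Φ.y.der) Ψ.y.der + inner ℝ Φ.z Ψ.z
      + K * τ * inner ℝ Φ.u Ψ.u + m * Φ.ξ * Ψ.ξ + M * Φ.η * Ψ.η
      + ϖ * craneFunctional σ α τ m M Φ * craneFunctional σ α τ m M Ψ := by
  have hi : Integrable (fun x => a.rep x * Φ.y.der x * Ψ.y.der x) unitMeasure :=
    (memLp_mul_L2 a.continuousOn_rep Φ.y.der).integrable_mul (Lp.memLp Ψ.y.der)
  rw [inner_mulL2, L2.inner_eq, L2.inner_eq, ← integral_add hi (Φ.z.integrable_mul Ψ.z)]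
  rfl

theorem craneFunctional_eq (σ α τ m M : ℝ) (Φ : StateSpace) :
    craneFunctional σ α τ m M Φ = σ * (∫ x in Ioo (0 : ℝ) 1, Φ.y.toL2 x)
      + (∫ x in Ioo (0 : ℝ) 1, Φ.z x) + m * Φ.ξ + M * Φ.η - α * Φ.y.at0
      + τ * α * ∫ x in Ioo (0 : ℝ) 1, Φ.u x := by
  unfold craneFunctional
  rw [integral_add (Φ.y.toL2.integrable.const_mul σ) Φ.z.integrable, integral_const_mul]

theorem H1.abs_integral_sub_at0_le (f : H1) :
    |(∫ x in Ioo (0 : ℝ) 1, f.toL2 x) - f.at0| ≤ ‖f.der‖ := by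
  have h : (∫ x in Ioo (0 : ℝ) 1, f.toL2 x) - f.at0
      = ∫ x in Ioo (0 : ℝ) 1, (f.toL2 x - f.at0) := by
    rw [integral_sub f.toL2.integrable (integrable_const _)]; simp
  rw [h]
  have hb : ∀ᵐ x ∂unitMeasure, ‖f.toL2 x - f.at0‖ ≤ ‖f.der‖ := by
    filter_upwards [f.toL2_ae_eq_rep, ae_unit_of_Icc fun x hx => f.abs_rep_sub_le hx] with x h1 h2
    rwa [h1]
  have := norm_integral_le_of_norm_le_const hb
  rwa [probReal_univ, mul_one] at this

theorem H1.norm_toL2_le_at0 (f : H1) : ‖f.toL2‖ ≤ |f.at0| + ‖f.der‖ := by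
  have h : ∀ᵐ x ∂unitMeasure, ‖f.toL2 x‖ ≤ |f.at0| + ‖f.der‖ := by
    filter_upwards [f.toL2_ae_eq_rep, ae_unit_of_Icc fun x hx => f.abs_rep_sub_le hx] with x h1 h2
    rw [h1]
    have := abs_sub_abs_le_abs_sub (f.rep x) f.at0
    rw [Real.norm_eq_abs]; linarith
  refine (Lp.norm_le_of_ae_bound (by positivity) h).trans (by simp [measureUnivNNReal])

theorem H1.norm_le_add (f : H1) : ‖f‖ ≤ ‖f.toL2‖ + ‖f.der‖ := by
  refine abs_le_of_sq_le_sq' ?_ (by positivity) |>.2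
  rw [f.norm_sq_eq]
  nlinarith [mul_nonneg (norm_nonneg f.toL2) (norm_nonneg f.der)]

theorem le_inv_sqrt_mul {c x N : ℝ} (hc : 0 < c) (hN : 0 ≤ N) (h : c * x ^ 2 ≤ N ^ 2) :
    |x| ≤ (√c)⁻¹ * N := by
  have hs := Real.sqrt_pos.2 hc
  rw [inv_mul_eq_div, le_div_iff₀ hs]
  refine abs_le_of_sq_le_sq' ?_ hN |>.2
  rw [mul_pow, Real.sq_sqrt hc.le, sq_abs]; linarith

theorem StateSpace.norm_components_le (Φ : StateSpace) :
    ‖Φ.y‖ ≤ ‖Φ‖ ∧ ‖Φ.z‖ ≤ ‖Φ‖ ∧ ‖Φ.u‖ ≤ ‖Φ‖ ∧ |Φ.ξ| ≤ ‖Φ‖ ∧ |Φ.η| ≤ ‖Φ‖ := by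
  have h1 := norm_snd_le Φ
  have h2 := (norm_snd_le Φ.2).trans h1
  have h3 := (norm_snd_le Φ.2.2).trans h2
  exact ⟨norm_fst_le Φ, (norm_fst_le Φ.2).trans h1, (norm_fst_le Φ.2.2).trans h2,
    (norm_fst_le Φ.2.2.2).trans h3, (norm_snd_le Φ.2.2.2).trans h3⟩

theorem StateSpace.norm_le {Φ : StateSpace} {C : ℝ} (hy : ‖Φ.y‖ ≤ C) (hz : ‖Φ.z‖ ≤ C)
    (hu : ‖Φ.u‖ ≤ C) (hξ : |Φ.ξ| ≤ C) (hη : |Φ.η| ≤ C) : ‖Φ‖ ≤ C := by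
  simp only [Prod.norm_def]
  exact max_le hy (max_le hz (max_le hu (max_le hξ hη)))

variable {a : H1} {a₀ σ α τ m M K ϖ : ℝ}

theorem abs_craneFunctional_le (hτ : 0 < τ) (hm : 0 < m) (hM : 0 < M) (Φ : StateSpace) :
    |craneFunctional σ α τ m M Φ| ≤ (|σ| + 1 + m + M + 2 * |α| + τ * |α|) * ‖Φ‖ := by
  obtain ⟨hy, hz, hu, hξ, hη⟩ := Φ.norm_components_le
  have h1 : |σ * ∫ x in Ioo (0 : ℝ) 1, Φ.y.toL2 x| ≤ |σ| * ‖Φ‖ := by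
    rw [abs_mul]; gcongr
    exact (Φ.y.toL2.abs_integral_le.trans Φ.y.norm_toL2_le).trans hy
  have h2 : |∫ x in Ioo (0 : ℝ) 1, Φ.z x| ≤ ‖Φ‖ := Φ.z.abs_integral_le.trans hz
  have h3 : |m * Φ.ξ| ≤ m * ‖Φ‖ := by rw [abs_mul, abs_of_pos hm]; gcongr
  have h4 : |M * Φ.η| ≤ M * ‖Φ‖ := by rw [abs_mul, abs_of_pos hM]; gcongr
  have h5 : |α * Φ.y.at0| ≤ |α| * (2 * ‖Φ‖) := by
    rw [abs_mul]; gcongr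
    linarith [Φ.y.abs_at0_le, Φ.y.norm_toL2_le, Φ.y.norm_der_le]
  have h6 : |τ * α * ∫ x in Ioo (0 : ℝ) 1, Φ.u x| ≤ τ * |α| * ‖Φ‖ := by
    rw [abs_mul, abs_mul, abs_of_pos hτ]; gcongr
    exact Φ.u.abs_integral_le.trans hu
  rw [craneFunctional_eq]
  rw [abs_le] at *
  constructor <;> linarith

/-- The energy controls `y'`, `z`, `u`, `ξ`, `η` and `ℓ` directly, and misses only the constant part
of `y`. Replacing the mean of `y` by `y(0)` costs `‖y'‖`, so `ℓ` determines `(σ - α) y(0)` up to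
controlled terms. This is where `σ ≠ α` enters. -/
theorem norm_le_of_energy (ha₀ : 0 < a₀) (ha : ∀ x ∈ Icc (0 : ℝ) 1, a₀ ≤ a.rep x)
    (hτ : 0 < τ) (hm : 0 < m) (hM : 0 < M) (hK : 0 < K) (hϖ : 0 < ϖ) (hσα : σ ≠ α) :
    ∃ C : ℝ, 0 < C ∧ ∀ (Φ : StateSpace) (N : ℝ), 0 ≤ N →
      energyInner a σ α τ m M K ϖ Φ Φ = N ^ 2 → ‖Φ‖ ≤ C * N := by
  have hKτ : 0 < K * τ := mul_pos hK hτ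
  -- Each summand is the constant for one term of the energy; the sum serves for all six.
  set k : ℝ := (√a₀)⁻¹ + (√1)⁻¹ + (√(K * τ))⁻¹ + (√m)⁻¹ + (√M)⁻¹ + (√ϖ)⁻¹ with hk
  have p1 : 0 < (√a₀)⁻¹ := inv_pos.2 (Real.sqrt_pos.2 ha₀)
  have p2 : 0 < (√1 : ℝ)⁻¹ := inv_pos.2 (Real.sqrt_pos.2 one_pos)
  have p3 : 0 < (√(K * τ))⁻¹ := inv_pos.2 (Real.sqrt_pos.2 hKτ)
  have p4 : 0 < (√m)⁻¹ := inv_pos.2 (Real.sqrt_pos.2 hm)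
  have p5 : 0 < (√M)⁻¹ := inv_pos.2 (Real.sqrt_pos.2 hM)
  have p6 : 0 < (√ϖ)⁻¹ := inv_pos.2 (Real.sqrt_pos.2 hϖ)
  set d : ℝ := |σ - α|⁻¹ * (2 + |σ| + m + M + τ * |α|) with hd
  have hσα' : 0 < |σ - α| := abs_pos.2 (sub_ne_zero.2 hσα)
  have hd0 : 0 < d := by positivity
  have hk0 : 0 < k := by positivity
  -- The `H¹` norm of `y` is at most `|y(0)| + 2 ‖y'‖`, whence `d + 2`.
  refine ⟨(d + 2) * k, by positivity, fun Φ N hN hE => ?_⟩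
  rw [energyInner_eq] at hE
  have e1 := le_inner_mulL2 ha Φ.y.der
  rw [real_inner_self_eq_norm_sq, real_inner_self_eq_norm_sq] at hE
  have q1 : 0 ≤ a₀ * ‖Φ.y.der‖ ^ 2 := by positivity
  have q2 : 0 ≤ ‖Φ.z‖ ^ 2 := by positivity
  have q3 : 0 ≤ K * τ * ‖Φ.u‖ ^ 2 := by positivity
  have q4 : 0 ≤ m * Φ.ξ ^ 2 := by positivity
  have q5 : 0 ≤ M * Φ.η ^ 2 := by positivity
  have q6 : 0 ≤ ϖ * craneFunctional σ α τ m M Φ ^ 2 := by positivity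
  have b1 : |‖Φ.y.der‖| ≤ k * N := (le_inv_sqrt_mul ha₀ hN (by linarith)).trans (by
    gcongr; linarith)
  have b2 : |‖Φ.z‖| ≤ k * N := (le_inv_sqrt_mul one_pos hN (by linarith)).trans (by
    gcongr; linarith)
  have b3 : |‖Φ.u‖| ≤ k * N := (le_inv_sqrt_mul hKτ hN (by linarith)).trans (by
    gcongr; linarith)
  have b4 : |Φ.ξ| ≤ k * N := (le_inv_sqrt_mul hm hN (by linarith)).trans (by
    gcongr; linarith)
  have b5 : |Φ.η| ≤ k * N := (le_inv_sqrt_mul hM hN (by linarith)).trans (by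
    gcongr; linarith)
  have b6 : |craneFunctional σ α τ m M Φ| ≤ k * N := (le_inv_sqrt_mul hϖ hN (by linarith)).trans (by
    gcongr; linarith)
  rw [abs_norm] at b1 b2 b3
  have b7 : |Φ.y.at0| ≤ d * (k * N) := by
    have e : (σ - α) * Φ.y.at0 = craneFunctional σ α τ m M Φ
        - σ * ((∫ x in Ioo (0 : ℝ) 1, Φ.y.toL2 x) - Φ.y.at0) - (∫ x in Ioo (0 : ℝ) 1, Φ.z x)
        - m * Φ.ξ - M * Φ.η - τ * α * ∫ x in Ioo (0 : ℝ) 1, Φ.u x := by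
      rw [craneFunctional_eq]; ring
    have h1 : |σ * ((∫ x in Ioo (0 : ℝ) 1, Φ.y.toL2 x) - Φ.y.at0)| ≤ |σ| * (k * N) := by
      rw [abs_mul]; gcongr; exact Φ.y.abs_integral_sub_at0_le.trans b1
    have h2 : |∫ x in Ioo (0 : ℝ) 1, Φ.z x| ≤ k * N := Φ.z.abs_integral_le.trans b2
    have h3 : |m * Φ.ξ| ≤ m * (k * N) := by rw [abs_mul, abs_of_pos hm]; gcongr
    have h4 : |M * Φ.η| ≤ M * (k * N) := by rw [abs_mul, abs_of_pos hM]; gcongr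
    have h6 : |τ * α * ∫ x in Ioo (0 : ℝ) 1, Φ.u x| ≤ τ * |α| * (k * N) := by
      rw [abs_mul, abs_mul, abs_of_pos hτ]; gcongr
      exact Φ.u.abs_integral_le.trans b3
    have h7 : |σ - α| * |Φ.y.at0| ≤ (2 + |σ| + m + M + τ * |α|) * (k * N) := by
      rw [← abs_mul, e]
      rw [abs_le] at h1 h2 h3 h4 h6 b6 ⊢
      constructor <;> linarith
    rw [hd, mul_assoc, inv_mul_eq_div, le_div_iff₀ hσα']
    linarith
  have hkN : 0 ≤ k * N := by positivity
  have hdkN : 0 ≤ d * (k * N) := by positivity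
  apply StateSpace.norm_le <;> try linarith
  linarith [Φ.y.norm_le_add, Φ.y.norm_toL2_le_at0]

theorem energy_le_of_norm (hτ : 0 < τ) (hm : 0 < m) (hM : 0 < M) (hK : 0 < K) (hϖ : 0 < ϖ) :
    ∃ C : ℝ, 0 < C ∧ ∀ Φ : StateSpace, energyInner a σ α τ m M K ϖ Φ Φ ≤ C ^ 2 * ‖Φ‖ ^ 2 := by
  set l : ℝ := |σ| + 1 + m + M + 2 * |α| + τ * |α| with hl
  have hp : 0 < ‖mulL2 a‖ + 1 + K * τ + m + M + ϖ * l ^ 2 := by positivity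
  refine ⟨√(‖mulL2 a‖ + 1 + K * τ + m + M + ϖ * l ^ 2), Real.sqrt_pos.2 hp, fun Φ => ?_⟩
  rw [Real.sq_sqrt hp.le, energyInner_eq, real_inner_self_eq_norm_sq, real_inner_self_eq_norm_sq]
  obtain ⟨hy, hz, hu, hξ, hη⟩ := Φ.norm_components_le
  have h0 := Φ.y.norm_der_le.trans hy
  have h1 : inner ℝ (mulL2 a Φ.y.der) Φ.y.der ≤ ‖mulL2 a‖ * ‖Φ‖ ^ 2 := by
    refine (real_inner_le_norm _ _).trans ?_
    calc ‖mulL2 a Φ.y.der‖ * ‖Φ.y.der‖ ≤ (‖mulL2 a‖ * ‖Φ‖) * ‖Φ‖ := by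
          gcongr
          exact (mulL2 a).le_opNorm_of_le h0
      _ = _ := by ring
  have h2 : ‖Φ.z‖ ^ 2 ≤ ‖Φ‖ ^ 2 := by gcongr
  have h3 : K * τ * ‖Φ.u‖ ^ 2 ≤ K * τ * ‖Φ‖ ^ 2 := by gcongr
  have h4 : m * Φ.ξ * Φ.ξ ≤ m * ‖Φ‖ ^ 2 := by
    rw [mul_assoc, ← pow_two, ← sq_abs]; gcongr
  have h5 : M * Φ.η * Φ.η ≤ M * ‖Φ‖ ^ 2 := by
    rw [mul_assoc, ← pow_two, ← sq_abs]; gcongr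
  have h6 : ϖ * craneFunctional σ α τ m M Φ * craneFunctional σ α τ m M Φ
      ≤ ϖ * l ^ 2 * ‖Φ‖ ^ 2 := by
    rw [mul_assoc, ← pow_two, ← sq_abs, mul_assoc, ← mul_pow]
    gcongr
    exact abs_craneFunctional_le hτ hm hM Φ
  linarith

theorem normEquivalent_energyCore (ha₀ : 0 < a₀) (ha : ∀ x ∈ Icc (0 : ℝ) 1, a₀ ≤ a.rep x)
    (hτ : 0 < τ) (hm : 0 < m) (hM : 0 < M) (hK : 0 < K) (hϖ : 0 < ϖ) (hσα : σ ≠ α) :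
    WithInner.NormEquivalent (energyCore ha₀ ha hτ hm hM hK hϖ hσα) := by
  obtain ⟨C, hC, h1⟩ := norm_le_of_energy ha₀ ha hτ hm hM hK hϖ hσα
  obtain ⟨D, hD, h2⟩ := energy_le_of_norm (a := a) (σ := σ) (α := α) hτ hm hM hK hϖ
  refine ⟨C⁻¹, D, inv_pos.2 hC, hD, fun Φ => ⟨?_, ?_⟩⟩
  · rw [inv_mul_le_iff₀ hC]
    exact h1 Φ _ (norm_nonneg _) (WithInner.norm_of_sq (energyCore ha₀ ha hτ hm hM hK hϖ hσα) Φ).symm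
  · refine abs_le_of_sq_le_sq' ?_ (by positivity) |>.2
    rw [WithInner.norm_of_sq, mul_pow]
    exact h2 Φ

end EnergyNorm

/-! ### Invariance of well-posedness under change of norm -/

section Transfer

variable {X Y : Type*} [NormedAddCommGroup X] [NormedSpace ℝ X] [NormedAddCommGroup Y]
  [NormedSpace ℝ Y] {A : X →ₗ.[ℝ] X} {B : Y →ₗ.[ℝ] Y}

/-- The correspondence of graphs encodes `B = e A e⁻¹` together with its domain, so domain
membership and values of the operator are carried over in one step. -/
theorem IsStrongSolution.map (e : X ≃L[ℝ] Y)
    (hAB : ∀ x y, (x, y) ∈ A.graph ↔ (e x, e y) ∈ B.graph) {x : X} {Φ : ℝ → X}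
    (h : IsStrongSolution A x Φ) : IsStrongSolution B (e x) (fun t => e (Φ t)) := by
  have hg : ∀ t (ht : 0 ≤ t), (e (Φ t), e (A ⟨Φ t, h.mem_domain t ht⟩)) ∈ B.graph :=
    fun t ht => (hAB _ _).1 (A.mem_graph ⟨Φ t, h.mem_domain t ht⟩)
  have hm : ∀ t, 0 ≤ t → e (Φ t) ∈ B.domain := fun t ht => B.mem_domain_of_mem_graph (hg t ht)
  refine ⟨by rw [h.initial], hm, e.contDiff.comp_contDiffOn h.contDiffOn, ?_, ?_⟩
  · refine (e.continuous.comp h.continuous_apply).congr fun t => ?_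
    exact (apply_eq_of_mem_graph (hg t t.2) _).symm
  · intro t ht
    rw [apply_eq_of_mem_graph (hg t ht)]
    exact (e : X →L[ℝ] Y).hasFDerivAt.comp_hasDerivWithinAt t (h.hasDerivWithinAt t ht)

theorem IsMildSolution.map [CompleteSpace X] [CompleteSpace Y] (e : X ≃L[ℝ] Y)
    (hAB : ∀ x y, (x, y) ∈ A.graph ↔ (e x, e y) ∈ B.graph) {x : X} {Φ : ℝ → X}
    (h : IsMildSolution A x Φ) : IsMildSolution B (e x) (fun t => e (Φ t)) := by
  refine ⟨e.continuous.comp_continuousOn h.continuousOn, fun t ht => ?_⟩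
  have hi : IntervalIntegrable Φ volume 0 t := by
    refine ContinuousOn.intervalIntegrable (h.continuousOn.mono ?_)
    rw [uIcc_of_le ht]; exact Icc_subset_Ici_self
  have e1 : ∫ s in (0 : ℝ)..t, e (Φ s) = e (∫ s in (0 : ℝ)..t, Φ s) :=
    (e : X →L[ℝ] Y).intervalIntegral_comp_comm hi
  rw [e1, ← map_sub, ← hAB]
  exact h.integral_mem_graph t ht

/-- Well-posedness is invariant under linear homeomorphisms. -/
theorem IsWellPosed.map [CompleteSpace X] [CompleteSpace Y] (e : X ≃L[ℝ] Y)
    (hAB : ∀ x y, (x, y) ∈ A.graph ↔ (e x, e y) ∈ B.graph) (h : IsWellPosed A) :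
    IsWellPosed B := by
  obtain ⟨hd, S, hS, hgen, hstrong, hmild⟩ := h
  have hBA : ∀ x y, (x, y) ∈ B.graph ↔ (e.symm x, e.symm y) ∈ A.graph := fun x y => by
    rw [hAB, e.apply_symm_apply, e.apply_symm_apply]
  let T : ℝ → Y →L[ℝ] Y := fun t => (e : X →L[ℝ] Y) ∘L S t ∘L (e.symm : Y →L[ℝ] X)
  have hT : ∀ t y, T t y = e (S t (e.symm y)) := fun t y => rfl
  refine ⟨?_, T, ⟨?_, ?_, ?_⟩, ?_, ?_, ?_⟩
  · refine (e.surjective.denseRange.dense_image e.continuous hd).mono ?_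
    rintro _ ⟨x, hx, rfl⟩
    exact B.mem_domain_of_mem_graph ((hAB _ _).1 (A.mem_graph ⟨x, hx⟩))
  · ext y
    rw [hT, hS.map_zero]; simp
  · intro s t hs ht
    ext y
    rw [hT, hS.map_add s t hs ht, ContinuousLinearMap.comp_apply, ContinuousLinearMap.comp_apply,
      hT, hT, e.symm_apply_apply]
  · intro y
    have := (e.continuous.tendsto _).comp (hS.tendsto_zero (e.symm y))
    rwa [e.apply_symm_apply] at this
  · intro x y
    rw [hBA, hgen]
    constructor
    · intro h
      have := (e.continuous.tendsto _).comp h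
      rw [e.apply_symm_apply] at this
      refine this.congr fun t => ?_
      simp [hT]
    · intro h
      refine ((e.symm.continuous.tendsto _).comp h).congr fun t => ?_
      simp [hT]
  · intro x hx
    have hx' : e.symm x ∈ A.domain :=
      A.mem_domain_of_mem_graph ((hBA _ _).1 (B.mem_graph ⟨x, hx⟩))
    obtain ⟨h1, h2⟩ := hstrong _ hx'
    refine ⟨?_, fun Ψ hΨ t ht => ?_⟩
    · have := h1.map e hAB
      rwa [e.apply_symm_apply] at this
    · exact (e.apply_symm_apply (Ψ t)).symm.trans (congrArg e (h2 _ (hΨ.map e.symm hBA) ht))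
  · intro x
    obtain ⟨h1, h2⟩ := hmild (e.symm x)
    refine ⟨?_, fun Ψ hΨ t ht => ?_⟩
    · have := h1.map e hAB
      rwa [e.apply_symm_apply] at this
    · exact (e.apply_symm_apply (Ψ t)).symm.trans (congrArg e (h2 _ (hΨ.map e.symm hBA) ht))

variable {V : Type*} [NormedAddCommGroup V] [NormedSpace ℝ V] {c : InnerProductSpace.Core ℝ V}

/-- The identity map as a linear homeomorphism, when the norms are equivalent. -/
theorem WithInner.NormEquivalent.exists_equiv (h : WithInner.NormEquivalent c) :
    ∃ e : V ≃L[ℝ] WithInner c, ∀ v, e v = WithInner.of c v := by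
  obtain ⟨C₁, C₂, h1, h2, h⟩ := h
  refine ⟨(WithInner.of c).toContinuousLinearEquivOfBounds C₂ C₁⁻¹ (fun v => (h v).2) fun v => ?_,
    fun v => rfl⟩
  rw [inv_mul_eq_div, le_div_iff₀ h1, mul_comm]
  simpa using (h ((WithInner.of c).symm v)).1

theorem WithInner.NormEquivalent.completeSpace [CompleteSpace V] (h : WithInner.NormEquivalent c) :
    CompleteSpace (WithInner c) := by
  obtain ⟨e, -⟩ := h.exists_equiv
  exact (completeSpace_congr (e := e.toEquiv) e.isUniformEmbedding).1 inferInstance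

theorem WithInner.mem_graph_operator (A : V →ₗ.[ℝ] V) (x y : V) :
    (x, y) ∈ A.graph ↔ (WithInner.of c x, WithInner.of c y) ∈ (WithInner.operator c A).graph := by
  rw [LinearPMap.mem_graph_iff, LinearPMap.mem_graph_iff]
  constructor
  · rintro ⟨v, h1, h2⟩
    exact ⟨⟨WithInner.of c v, v.2⟩, congrArg (WithInner.of c) h1, congrArg (WithInner.of c) h2⟩
  · rintro ⟨v, h1, h2⟩
    exact ⟨⟨(WithInner.of c).symm v, v.2⟩, (WithInner.of c).injective h1,
      (WithInner.of c).injective h2⟩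

theorem isWellPosed_operator_iff [CompleteSpace V] (h : WithInner.NormEquivalent c)
    (A : V →ₗ.[ℝ] V) : IsWellPosed (WithInner.operator c A) ↔ IsWellPosed A := by
  have := h.completeSpace
  obtain ⟨e, he⟩ := h.exists_equiv
  have hAB : ∀ x y, (x, y) ∈ A.graph ↔ (e x, e y) ∈ (WithInner.operator c A).graph :=
    fun x y => by rw [he, he]; exact WithInner.mem_graph_operator A x y
  refine ⟨fun hw => hw.map e.symm fun x y => ?_, fun hw => hw.map e hAB⟩
  rw [hAB, e.apply_symm_apply, e.apply_symm_apply]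

end Transfer

/-! ### Quasi-dissipativity of the crane operator -/

section Generator

theorem domY'_eq {Φ : craneDomain} {f : H1} (h : f.toL2 = Φ.1.y.der) : domY' Φ = f :=
  H1.toL2_injective ((toL2_domY' Φ).trans h.symm)

theorem domZ_eq {Φ : craneDomain} {f : H1} (h : f.toL2 = Φ.1.z) : domZ Φ = f :=
  H1.toL2_injective ((toL2_domZ Φ).trans h.symm)

theorem domU_eq {Φ : craneDomain} {f : H1} (h : f.toL2 = Φ.1.u) : domU Φ = f :=
  H1.toL2_injective ((toL2_domU Φ).trans h.symm)

theorem craneDomain_boundary (Φ : craneDomain) :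
    Φ.1.ξ = (domU Φ).at0 ∧ Φ.1.ξ = (domZ Φ).at0 ∧ Φ.1.η = (domZ Φ).at1 := by
  obtain ⟨y', z, u, -, h2, h3, h4, h5, h6⟩ := Φ.2
  rw [domU_eq h3, domZ_eq h2]
  exact ⟨h4, h4.trans h5, h6⟩

/-- The mean value of a function in `L²(0, 1)`. -/
def L2.mean : L2 →ₗ[ℝ] ℝ where
  toFun f := ∫ x in Ioo (0 : ℝ) 1, f x
  map_add' f g := by
    rw [← integral_add f.integrable g.integrable]
    exact integral_congr_ae (L2.ae_add f g)
  map_smul' c f := by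
    rw [RingHom.id_apply, smul_eq_mul, ← integral_const_mul]
    exact integral_congr_ae (L2.ae_smul c f)

theorem craneFunctional_eq_mean (σ α τ m M : ℝ) (Φ : StateSpace) :
    craneFunctional σ α τ m M Φ = σ * L2.mean Φ.y.toL2 + L2.mean Φ.z + m * Φ.ξ + M * Φ.η
      - α * Φ.y.at0 + τ * α * L2.mean Φ.u :=
  craneFunctional_eq σ α τ m M Φ

theorem H1.mean_der (f : H1) : L2.mean f.der = f.at1 - f.at0 := by
  obtain ⟨F, hF, hF1, hF2⟩ := f.exists_ac_rep
  change ∫ x in Ioo (0 : ℝ) 1, f.der x = f.rep 1 - f.rep 0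
  rw [integral_congr_ae hF2, setIntegral_eq_interval, hF.integral_deriv_eq_sub, hF1 (by simp),
    hF1 (by simp)]

variable {a : H1} {a₀ σ α τ m M K ϖ : ℝ}

theorem craneOperator_apply (Φ : craneDomain) : craneOperator a σ α τ m M Φ =
    (domZ Φ, (H1.mulLeft a (domY' Φ)).der - σ • Φ.1.z, -(τ⁻¹ • (domU Φ).der),
      (1 / m) * ((H1.mulLeft a (domY' Φ)).at0 + α * (domU Φ).at1),
      -((H1.mulLeft a (domY' Φ)).at1 / M)) := rfl

/-- All boundary values telescope: the flux `a y'` at both ends against the `ξ` and `η` components,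
`α u(1)` against the delay integral, and `α z(0)` against `α u(0)`. For `σ' = σ` the functional
annihilates the range of the operator; the extra parameter allows the auxiliary choice `σ' = α + 1`.
-/
theorem craneFunctional_craneOperator (σ' : ℝ) (hτ : τ ≠ 0) (hm : m ≠ 0) (hM : M ≠ 0)
    (Φ : craneDomain) : craneFunctional σ' α τ m M (craneOperator a σ α τ m M Φ)
      = (σ' - σ) * L2.mean Φ.1.z := by
  obtain ⟨h1, h2, -⟩ := craneDomain_boundary Φ
  rw [craneFunctional_eq_mean, craneOperator_apply]
  simp only [StateSpace.y, StateSpace.z, StateSpace.u, StateSpace.ξ, StateSpace.η, map_sub,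
    map_neg, map_smul, H1.mean_der, smul_eq_mul]
  rw [toL2_domZ, ← h2, ← h1]
  field_simp
  ring

/-- Integrating by parts with the flux `w = a y'` against `z` produces boundary terms that the two
masses cancel exactly. Damping, the boundary terms of the delay and the contribution of `ℓ` remain.
-/
theorem energyInner_craneOperator (σ' : ℝ) (hτ : τ ≠ 0) (hm : m ≠ 0) (hM : M ≠ 0)
    (Φ : craneDomain) : energyInner a σ' α τ m M K ϖ (craneOperator a σ α τ m M Φ) Φ
      = -σ * ‖Φ.1.z‖ ^ 2 - K / 2 * ((domU Φ).at1 ^ 2 - Φ.1.ξ ^ 2) + α * (domU Φ).at1 * Φ.1.ξ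
        + ϖ * ((σ' - σ) * L2.mean Φ.1.z) * craneFunctional σ' α τ m M Φ := by
  obtain ⟨h1, h2, h3⟩ := craneDomain_boundary Φ
  rw [energyInner_eq, craneFunctional_craneOperator σ' hτ hm hM, craneOperator_apply]
  set w := H1.mulLeft a (domY' Φ) with hw
  have hwt : w.toL2 = mulL2 a Φ.1.y.der := by
    rw [hw, H1.toL2_mulLeft_eq, toL2_domY']
  have e1 := w.inner_der_add (domZ Φ)
  have e2 := (domU Φ).inner_der_add (domU Φ)
  rw [real_inner_comm (domU Φ).der, toL2_domU] at e2
  rw [toL2_domZ, hwt] at e1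
  have e3 : inner ℝ (domU Φ).der Φ.1.u = ((domU Φ).at1 ^ 2 - Φ.1.ξ ^ 2) / 2 := by
    rw [h1]; linarith
  have e4 : inner ℝ (mulL2 a (domZ Φ).der) Φ.1.y.der = w.at1 * Φ.1.η - w.at0 * Φ.1.ξ
      - inner ℝ w.der Φ.1.z := by
    rw [inner_mulL2_comm, h2, h3]; linarith
  simp only [StateSpace.y, StateSpace.z, StateSpace.u, StateSpace.ξ, StateSpace.η] at *
  rw [inner_sub_left, inner_neg_left, real_inner_smul_left, real_inner_smul_left,
    real_inner_self_eq_norm_sq, e3, e4]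
  field_simp
  ring

theorem energyInner_craneOperator_le (ha₀ : 0 < a₀) (ha : ∀ x ∈ Icc (0 : ℝ) 1, a₀ ≤ a.rep x)
    (hσ : 0 < σ) (hτ : 0 < τ) (hm : 0 < m) (hM : 0 < M) (Φ : craneDomain) :
    energyInner a (α + 1) α τ m M 1 1 (craneOperator a σ α τ m M Φ) Φ
      ≤ ((1 + α ^ 2) / m + |α + 1 - σ|) * energyInner a (α + 1) α τ m M 1 1 Φ Φ := by
  rw [energyInner_craneOperator _ hτ.ne' hm.ne' hM.ne', energyInner_eq,
    real_inner_self_eq_norm_sq, real_inner_self_eq_norm_sq]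
  have q0 := le_inner_mulL2 ha Φ.1.y.der
  have q1 : 0 ≤ a₀ * ‖Φ.1.y.der‖ ^ 2 := by positivity
  have q2 : |L2.mean Φ.1.z| ≤ ‖Φ.1.z‖ := Φ.1.z.abs_integral_le
  have q3 : 0 ≤ σ * ‖Φ.1.z‖ ^ 2 := by positivity
  have q4 : 0 ≤ τ * ‖Φ.1.u‖ ^ 2 := by positivity
  have q5 : 0 ≤ M * Φ.1.η ^ 2 := by positivity
  have q6 : 0 ≤ m * Φ.1.ξ ^ 2 := by positivity
  set l := craneFunctional (α + 1) α τ m M Φ.1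
  set Z := ‖Φ.1.z‖
  set x := Φ.1.ξ
  set v := (domU Φ).at1
  -- The price of replacing `σ` by `α + 1` in `ℓ`: a product of two quantities that the energy
  -- controls.
  have r1 : (α + 1 - σ) * L2.mean Φ.1.z * l ≤ |α + 1 - σ| * (Z ^ 2 + l ^ 2) := by
    refine (le_abs_self _).trans ?_
    rw [mul_assoc, abs_mul, abs_mul]
    gcongr
    calc |L2.mean Φ.1.z| * |l| ≤ Z * |l| := by gcongr
      _ ≤ Z ^ 2 + l ^ 2 := by nlinarith [sq_nonneg (Z - |l|), sq_abs l, sq_nonneg Z, sq_nonneg l]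
  -- Completing the square in `v`, the left side equals `-(v - α x)² / 2 + (1 + α²) x² / 2`. The
  -- uncontrolled trace `v = u(1)` thus disappears.
  have r2 : -(1 / 2) * (v ^ 2 - x ^ 2) + α * v * x ≤ (1 + α ^ 2) * x ^ 2 := by
    nlinarith [sq_nonneg (v - α * x), sq_nonneg x, sq_nonneg (α * x)]
  have r3 : (1 + α ^ 2) * x ^ 2 = (1 + α ^ 2) / m * (m * x ^ 2) := by field_simp
  have p1 : 0 ≤ (1 + α ^ 2) / m := by positivity
  have p2 : 0 ≤ |α + 1 - σ| := abs_nonneg _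
  have s1 : (1 + α ^ 2) / m * (m * x ^ 2) ≤ (1 + α ^ 2) / m *
      (inner ℝ (mulL2 a Φ.1.y.der) Φ.1.y.der + Z ^ 2 + 1 * τ * ‖Φ.1.u‖ ^ 2 + m * x * x
        + M * Φ.1.η * Φ.1.η + 1 * l * l) := by
    gcongr
    nlinarith [sq_nonneg Z, sq_nonneg l]
  have s2 : |α + 1 - σ| * (Z ^ 2 + l ^ 2) ≤ |α + 1 - σ| *
      (inner ℝ (mulL2 a Φ.1.y.der) Φ.1.y.der + Z ^ 2 + 1 * τ * ‖Φ.1.u‖ ^ 2 + m * x * x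
        + M * Φ.1.η * Φ.1.η + 1 * l * l) :=
    mul_le_mul_of_nonneg_left (by nlinarith) p2
  rw [add_mul]
  linarith

end Generator

/-! ### Solving the resolvent equation -/

section Range

theorem H1.exists_of_contDiff {F : ℝ → ℝ} (hF : ContDiff ℝ 1 F) :
    ∃ f : H1, EqOn f.rep F (Icc 0 1) ∧ f.der =ᵐ[unitMeasure] deriv F := by
  have hm := memLp_mul_L2 (F := deriv F) (hF.continuous_deriv le_rfl).continuousOn
    (Lp.const 2 unitMeasure (1 : ℝ))
  have he : (hm.toLp _ : L2) =ᵐ[unitMeasure] deriv F := by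
    filter_upwards [hm.coeFn_toLp, Lp.coeFn_const (p := 2) (μ := unitMeasure) (1 : ℝ)] with x h1 h2
    rw [h1, h2]; simp
  obtain ⟨f, h1, h2⟩ := H1.exists_of_ac hF.contDiffOn.absolutelyContinuousOnInterval he
  exact ⟨f, h1, by rw [h2]; exact he⟩

theorem H1.exists_boundary (c d : ℝ) : ∃ f : H1, f.at0 = c ∧ f.at1 = d := by
  obtain ⟨f, hf, -⟩ := H1.exists_of_contDiff (F := fun x => c + (d - c) * x) (by fun_prop)
  refine ⟨f, (hf (by simp)).trans (by simp), (hf (by simp)).trans (by simp)⟩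

theorem H1.exists_exp (c : ℝ) : ∃ f : H1, (∀ x ∈ Icc (0 : ℝ) 1, f.rep x = Real.exp (c * x)) ∧
    f.der = c • f.toL2 := by
  obtain ⟨f, hf, hf'⟩ := H1.exists_of_contDiff (F := fun x => Real.exp (c * x)) (by fun_prop)
  refine ⟨f, hf, ?_⟩
  apply Lp.ext
  filter_upwards [hf', L2.ae_smul c f.toL2, f.toL2_ae_eq_rep, ae_unit_of_Icc hf] with x h1 h2 h3 h4
  rw [h1, h2, h3, h4]
  have := ((hasDerivAt_id x).const_mul c).exp
  simp only [id, mul_one] at this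
  rw [this.deriv, mul_comm]

/-- The resolvent equation `lam u + u' / τ = h` of the transport part. -/
theorem exists_transport (lam τ : ℝ) (h : L2) : ∃ d : ℝ, ∀ ξ : ℝ, ∃ u : H1, u.at0 = ξ ∧
    u.at1 = Real.exp (-(lam * τ)) * ξ + d ∧ u.der = τ • (h - lam • u.toL2) := by
  -- Variation of constants: `u = E (P + ξ)`, where `E` is the decaying exponential, `F` its
  -- inverse, `P' = τ F h` and `P(0) = 0`. Only the term `ξ E` depends on `ξ`, so `d = (E P)(1)` is
  -- independent of it.
  obtain ⟨E, hE, hE'⟩ := H1.exists_exp (-(lam * τ))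
  obtain ⟨F, hF, -⟩ := H1.exists_exp (lam * τ)
  obtain ⟨P, hP, hP0⟩ := H1.exists_primitive (τ • mulL2 F h) 0
  have hEF : mulL2 E (mulL2 F h) = h := by
    apply Lp.ext
    filter_upwards [mulL2_ae E (mulL2 F h), mulL2_ae F h, ae_unit_of_Icc hE, ae_unit_of_Icc hF]
      with x h1 h2 h3 h4
    rw [h1, h2, h3, h4, ← mul_assoc, ← Real.exp_add]
    simp
  have hPE : mulL2 P E.toL2 = mulL2 E P.toL2 := by
    apply Lp.ext
    filter_upwards [mulL2_ae P E.toL2, mulL2_ae E P.toL2, E.toL2_ae_eq_rep, P.toL2_ae_eq_rep]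
      with x h1 h2 h3 h4
    rw [h1, h2, h3, h4, mul_comm]
  have hE0 : E.at0 = 1 := (hE 0 (by simp)).trans (by simp)
  have hE1 : E.at1 = Real.exp (-(lam * τ)) := (hE 1 (by simp)).trans (by simp)
  refine ⟨(H1.mulLeft E P).at1, fun ξ => ⟨H1.mulLeft E P + ξ • E, ?_, ?_, ?_⟩⟩
  · rw [map_add, map_smul, H1.at0_mulLeft, hP0, hE0]; simp
  · rw [map_add, map_smul, hE1, smul_eq_mul]; ring
  · rw [map_add, map_add, map_smul, map_smul, H1.der_mulLeft, hP, map_smul, hEF, hE', map_smul,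
      hPE, H1.toL2_mulLeft_eq]
    module

variable {a : H1} {a₀ : ℝ}

/-- The elliptic boundary value problem `(a y')' = c y - g` with Robin boundary conditions. -/
theorem exists_elliptic (ha₀ : 0 < a₀) (ha : ∀ x ∈ Icc (0 : ℝ) 1, a₀ ≤ a.rep x) {c k₀ k₁ : ℝ}
    (hc : 0 < c) (hk₀ : 0 ≤ k₀) (hk₁ : 0 ≤ k₁) (g : L2) (b₀ b₁ : ℝ) :
    ∃ y Y : H1, Y.toL2 = y.der ∧ (H1.mulLeft a Y).der = c • y.toL2 - g ∧
      (H1.mulLeft a Y).at0 = k₀ * y.at0 - b₀ ∧ (H1.mulLeft a Y).at1 = b₁ - k₁ * y.at1 := by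
  let I : L2 →L[ℝ] L2 →L[ℝ] ℝ :=
    (isBoundedBilinearMap_inner (𝕜 := ℝ) (E := L2)).toContinuousLinearMap
  -- The Robin conditions enter as natural boundary conditions, through trace terms with nonnegative
  -- weights. Coercivity comes from the first two terms alone.
  let B : H1 →L[ℝ] H1 →L[ℝ] ℝ :=
    I.bilinearComp (mulL2 a ∘L H1.derL) H1.derL
      + c • I.bilinearComp H1.toL2L H1.toL2L
      + k₀ • (ContinuousLinearMap.mul ℝ ℝ).bilinearComp H1.at0L H1.at0L
      + k₁ • (ContinuousLinearMap.mul ℝ ℝ).bilinearComp H1.at1L H1.at1L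
  have hB : ∀ y v, B y v = inner ℝ (mulL2 a y.der) v.der + c * inner ℝ y.toL2 v.toL2
      + k₀ * (y.at0 * v.at0) + k₁ * (y.at1 * v.at1) := fun y v => rfl
  have hco : IsCoercive B := by
    refine ⟨min a₀ c, lt_min ha₀ hc, fun y => ?_⟩
    rw [hB, real_inner_self_eq_norm_sq, mul_assoc, ← pow_two, y.norm_sq_eq]
    have h1 := le_inner_mulL2 ha y.der
    have h2 : min a₀ c * ‖y.der‖ ^ 2 ≤ a₀ * ‖y.der‖ ^ 2 := by gcongr; exact min_le_left _ _
    have h3 : min a₀ c * ‖y.toL2‖ ^ 2 ≤ c * ‖y.toL2‖ ^ 2 := by gcongr; exact min_le_right _ _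
    have h4 := mul_nonneg hk₀ (mul_self_nonneg y.at0)
    have h5 := mul_nonneg hk₁ (mul_self_nonneg y.at1)
    linarith
  let L : H1 →L[ℝ] ℝ := innerSL ℝ g ∘L H1.toL2L + b₀ • H1.at0L + b₁ • H1.at1L
  have hL : ∀ v, L v = inner ℝ g v.toL2 + b₀ * v.at0 + b₁ * v.at1 := fun v => rfl
  let y : H1 := hco.continuousLinearEquivOfBilin.symm ((InnerProductSpace.toDual ℝ H1).symm L)
  have hy : ∀ v, B y v = L v := fun v => by
    rw [← hco.continuousLinearEquivOfBilin_apply, ContinuousLinearEquiv.apply_symm_apply,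
      InnerProductSpace.toDual_symm_apply]
  -- Test functions have zero traces, so the variational identity restricted to them is the
  -- differential equation in weak form; the flux `a y'` therefore lies in `H¹`.
  have hw : IsWeakDeriv (mulL2 a y.der) (c • y.toL2 - g) := by
    intro φ h1 h2 h3
    obtain ⟨v, hv, hv'⟩ := H1.exists_of_contDiff (h1.of_le (by norm_num))
    have hv0 : v.at0 = 0 := (hv (by simp)).trans (test_zero h3).1
    have hv1 : v.at1 = 0 := (hv (by simp)).trans (test_zero h3).2
    have e1 : ∫ x in Ioo (0 : ℝ) 1, mulL2 a y.der x * deriv φ x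
        = inner ℝ (mulL2 a y.der) v.der := by
      rw [L2.inner_eq]
      exact integral_congr_ae (hv'.mono fun x hx => by simp only [hx])
    have e2 : ∫ x in Ioo (0 : ℝ) 1, (c • y.toL2 - g) x * φ x
        = inner ℝ (c • y.toL2 - g) v.toL2 := by
      rw [L2.inner_eq]
      apply integral_congr_ae
      filter_upwards [v.toL2_ae_eq_rep, ae_unit_of_Icc hv] with x h4 h5
      rw [h4, h5]
    have := hy v
    rw [hB, hL, hv0, hv1] at this
    rw [e1, e2, inner_sub_left, real_inner_smul_left]
    linarith
  let w : H1 := ⟨WithLp.toLp 2 (mulL2 a y.der, c • y.toL2 - g), hw⟩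
  have hw1 : w.toL2 = mulL2 a y.der := rfl
  have hw2 : w.der = c • y.toL2 - g := rfl
  obtain ⟨Y, hY, hYw⟩ := H1.exists_mulL2_eq ha₀ ha hw1
  -- With the equation known in the interior, integration by parts leaves only boundary terms in the
  -- variational identity. Choosing `v` with traces `(1, 0)` and `(0, 1)` isolates the two
  -- conditions.
  have hbd : ∀ v : H1, w.at1 * v.at1 - w.at0 * v.at0
      = (b₁ - k₁ * y.at1) * v.at1 - (k₀ * y.at0 - b₀) * v.at0 := by
    intro v
    have h1 := w.inner_der_add v
    have h2 := hy v
    rw [hB, hL] at h2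
    rw [hw1, hw2, inner_sub_left, real_inner_smul_left] at h1
    linarith
  refine ⟨y, Y, hY, by rw [hYw, hw2], ?_, ?_⟩
  · obtain ⟨v, h0, h1⟩ := H1.exists_boundary 1 0
    have := hbd v
    rw [h0, h1] at this
    rw [hYw]; linarith
  · obtain ⟨v, h0, h1⟩ := H1.exists_boundary 0 1
    have := hbd v
    rw [h0, h1] at this
    rw [hYw]; linarith

variable {σ α τ m M : ℝ}

/-- The first equation gives `z = l y - f`, the delay gives `u(1) = e z(0) + d`, and `ξ`, `η` are
traces of `z`. The remaining equations form a Robin problem for `y` alone. -/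
theorem craneOperator_range (ha₀ : 0 < a₀) (ha : ∀ x ∈ Icc (0 : ℝ) 1, a₀ ≤ a.rep x)
    (hσ : 0 < σ) (hα : 0 < α) (hτ : 0 < τ) (hm : 0 < m) (hM : 0 < M) {l : ℝ} (hl : α / m < l)
    (Ψ : StateSpace) :
    ∃ Φ : (craneOperator a σ α τ m M).domain, l • (Φ : StateSpace)
      - craneOperator a σ α τ m M Φ = Ψ := by
  obtain ⟨f, g, h, p, q⟩ := Ψ
  have hl0 : 0 < l := (div_pos hα hm).trans hl
  obtain ⟨d, hd⟩ := exists_transport l τ h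
  set e := Real.exp (-(l * τ)) with he
  have he1 : e ≤ 1 := Real.exp_le_one_iff.2 (by nlinarith [mul_pos hl0 hτ])
  -- This is why `l > α / m` is assumed: the delayed feedback, damped by `e ≤ 1`, then leaves the
  -- Robin coefficient at `0` nonnegative.
  have hk : 0 ≤ m * l - α * e := by
    have h1 : α < l * m := (div_lt_iff₀ hm).1 hl
    nlinarith
  -- The coefficients result from inserting `z = l y - f` into the second equation and into the `ξ`
  -- and `η` equations multiplied by `m` and `M`.
  obtain ⟨y, Y, hY, hw, hw0, hw1⟩ := exists_elliptic ha₀ ha (c := (l + σ) * l)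
    (k₀ := (m * l - α * e) * l) (k₁ := M * l ^ 2) (by positivity) (by positivity) (by positivity)
    ((l + σ) • f.toL2 + g) ((m * l - α * e) * f.at0 + α * d + m * p) (M * q + M * l * f.at1)
  let z : H1 := l • y - f
  have hz2 : z.toL2 = l • y.toL2 - f.toL2 := by simp only [z, map_sub, map_smul]
  have hz0 : z.at0 = l * y.at0 - f.at0 := by simp only [z, map_sub, map_smul, smul_eq_mul]
  have hz1 : z.at1 = l * y.at1 - f.at1 := by simp only [z, map_sub, map_smul, smul_eq_mul]
  obtain ⟨u, hu0, hu1, hu⟩ := hd z.at0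
  let Φ : craneDomain := ⟨(y, z.toL2, u.toL2, z.at0, z.at1), Y, z, u, hY, rfl, rfl, hu0.symm, hu0, rfl⟩
  have eY : domY' Φ = Y := domY'_eq hY
  have eZ : domZ Φ = z := domZ_eq rfl
  have eU : domU Φ = u := domU_eq rfl
  refine ⟨Φ, ?_⟩
  change l • ((y, z.toL2, u.toL2, z.at0, z.at1) : StateSpace) - craneOperator a σ α τ m M Φ = _
  rw [craneOperator_apply, eY, eZ, eU, hw, hw0, hw1, hu, hu1]
  change l • ((y, z.toL2, u.toL2, z.at0, z.at1) : StateSpace)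
    - (z, (((l + σ) * l) • y.toL2 - ((l + σ) • f.toL2 + g)) - σ • z.toL2, _, _, _) = _
  simp only [Prod.smul_mk, Prod.mk_sub_mk, Prod.mk.injEq, smul_eq_mul]
  refine ⟨?_, ?_, ?_, ?_, ?_⟩
  · simp only [z]; abel
  · rw [hz2]; module
  · rw [smul_smul, inv_mul_cancel₀ hτ.ne']; module
  · rw [hz0]; field_simp; ring
  · rw [hz1]; field_simp; ring

end Range

end Crane

end

/-! ### Assembly of the main theorem -/

theorem mainTheorem8 (a : Crane.H1) (a₀ : ℝ) (ha₀ : 0 < a₀)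
    (ha : ∀ x ∈ Set.Icc (0 : ℝ) 1, a₀ ≤ a.rep x)
    (σ α τ m M K : ℝ) (hσ : 0 < σ) (hα : 0 < α) (hτ : 0 < τ) (hm : 0 < m) (hM : 0 < M)
    (hK : 0 < K) (hαK : α ≤ K) :
    Crane.IsWellPosed (Crane.craneOperator a σ α τ m M) ∧
    ∀ (ϖ : ℝ) (hϖ : 0 < ϖ) (hσα : σ ≠ α),
      Crane.WithInner.NormEquivalent (Crane.energyCore ha₀ ha hτ hm hM hK hϖ hσα) ∧
      Crane.IsWellPosed (Crane.WithInner.operator (Crane.energyCore ha₀ ha hτ hm hM hK hϖ hσα)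
        (Crane.craneOperator a σ α τ m M)) := by
  -- The value `α + 1` replaces `σ` inside `ℓ` only, not in the operator, so the auxiliary energy is
  -- definite for every `σ`.
  have hα1 : α + 1 ≠ α := (lt_add_one α).ne'
  have hne := Crane.normEquivalent_energyCore ha₀ ha hτ hm hM one_pos one_pos hα1
  have hcs := hne.completeSpace
  have hA : Crane.IsWellPosed (Crane.craneOperator a σ α τ m M) := by
    rw [← Crane.isWellPosed_operator_iff hne]
    refine Crane.IsQuasiDissipative.isWellPosed (κ := (1 + α ^ 2) / m + |α + 1 - σ|)
      (lam₀ := α / m) (fun x => ?_) fun l hl y => ?_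
    · have := Crane.energyInner_craneOperator_le (α := α) ha₀ ha hσ hτ hm hM ⟨x.1, x.2⟩
      rw [← real_inner_self_eq_norm_sq]
      exact this
    · obtain ⟨Φ, hΦ⟩ := Crane.craneOperator_range ha₀ ha hσ hα hτ hm hM hl y
      exact ⟨⟨Φ.1, Φ.2⟩, hΦ⟩
  refine ⟨hA, fun ϖ hϖ hσα => ?_⟩
  have hne' := Crane.normEquivalent_energyCore ha₀ ha hτ hm hM hK hϖ hσα
  -- The inner product of part (B) needs only norm equivalence; well-posedness is transferred from
  -- the product norm without a further dissipativity estimate.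
  exact ⟨hne', (Crane.isWellPosed_operator_iff hne' _).2 hA⟩
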